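/- Let $o\in\mathcal X$ be a germ of a normal complex algebraic variety of dimension at least $3$ which is non-singular outside the point $o$ and whose canonical divisor is $\mathbb Q$-Cartier. Let $\varphi\colon\mathcal X^+\to\mathcal X$ be the blow up of the point $o$. Assume that the scheme-theoretic fibre $\mathcal Q=\varphi^{-1}(o)$ is irreducible, reduced and non-singular in codimension $1$, that is, $\operatorname{codim}(\operatorname{Sing}\mathcal Q\subset\mathcal Q)\geqslant 2$, and that its discrepancy is $a(\mathcal Q,\mathcal X)=1$. Let $n\geqslant 1$ be an integer and $\mathcal D$ an effective divisor on $\mathcal X$ with strict transform $\mathcal D^+$ on $\mathcal X^+$, such that $\mathcal D^+\sim-\nu\mathcal Q$ for an integer $\nu\leqslant 2n$. Assume that the pair $(\mathcal X,\frac1n\mathcal D)$ is canonical outside the point $o$, but not log canonical, and that $\mathcal E\neq\mathcal Q$ is a non log canonical singularity of this pair, that is, a prime divisor over $\mathcal X$ with $\operatorname{ord}_{\mathcal E}\mathcal D>n\,(a(\mathcal E,\mathcal X)+1)$, whose centre on $\mathcal X^+$ is a prime divisor $\mathcal W\subset\mathcal Q$. Then: (i) $\mathcal W$ enters the scheme-theoretic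 intersection $(\mathcal D^+\circ\mathcal Q)$ with a (finite) multiplicity $\mu_{\mathcal W}>n$; (ii) if moreover $\nu\geqslant n$, then $\nu+\operatorname{mult}_{\mathcal W}\mathcal D^+>2n$. -/

import Mathlib

open IsLocalRing

noncomputable section

namespace SingGerm

/-! Throughout, `A = 𝒪_{X,o}` is the local ring of the germ `o ∈ X` and `K` is the field of rational
functions.  A (scheme) point of an integral separated scheme with function field `K` is recorded by
its local ring, a subring of `K`; inclusion `R ≤ R'` of the local rings of two points of one such
scheme means that the first point lies in the closure of the second. -/

/-- The length of `R ⧸ I`, as an `R`-module. -/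
def colength {R : Type*} [CommRing R] (I : Ideal R) : ℕ∞ := Module.length R (R ⧸ I)

section Divisors

variable (A K : Type*) [CommRing A] [Field K] [Algebra A K]

/-- A prime divisor over the germ `X = Spec A`: the local ring in `K` of a prime divisor of a normal
variety with a birational morphism to `X`, that is, a discrete valuation ring between `A` and `K`
which is essentially of finite type over `A`. -/
@[ext]
structure DivisorOver where
  /-- The local ring of the divisor. -/
  ring : Subalgebra A K
  isDVR : IsDiscreteValuationRing ring
  essFiniteType : Algebra.EssFiniteType A ring

variable {A K}

namespace DivisorOver

variable (E : DivisorOver A K)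

instance : IsDiscreteValuationRing E.ring := E.isDVR

instance [IsFractionRing A K] : IsFractionRing E.ring K :=
  IsFractionRing.of_field E.ring K fun z => by
    obtain ⟨a, b, _, rfl⟩ := IsFractionRing.div_surjective (A := A) z
    exact ⟨algebraMap A E.ring a, algebraMap A E.ring b, rfl⟩

/-- The centre of `E` on `X`, as a prime ideal of `A`. -/
def center : Ideal A := (maximalIdeal E.ring).comap (algebraMap A E.ring)

/-- The order `ord_E z` of a rational function `z ≠ 0` along `E`. -/
def ord [IsFractionRing A K] (z : K) : ℤ := WithZero.log (Ring.ordFrac E.ring z)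

end DivisorOver

variable (A K) in
/-- The prime divisors on `X` itself: the divisors over `X` whose centre on `X` has codimension one. -/
abbrev PrimeDivisor : Type _ := {E : DivisorOver A K // E.center.height = 1}

variable [IsFractionRing A K]

/-- A Weil divisor on `X` (given by its coefficients) is `ℚ`-Cartier if a positive multiple of it is
the divisor of a rational function (`X` is the spectrum of a local ring). -/
def IsQCartier (D : PrimeDivisor A K → ℤ) : Prop :=
  ∃ p : ℕ × K, 0 < p.1 ∧ p.2 ≠ 0 ∧ ∀ P, P.1.ord p.2 = p.1 * D P

open Classical in
/-- The order `ord_E D` along `E` of the pull back of the `ℚ`-Cartier divisor `D` on `X`: if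
`r D = div f`, it is `ord_E f / r`. On a normal `X` the choice of `r` and `f` does not matter. -/
def pullbackOrd (D : PrimeDivisor A K → ℤ) (E : DivisorOver A K) : ℚ :=
  if h : IsQCartier D then (E.ord h.choose.2 : ℚ) / h.choose.1 else 0

section Discrepancy

variable [Algebra ℂ K] {d : ℕ}

/-- The regular differential forms of degree `d` at the generic point of `E`: the image of
`⋀^d Ω[𝒪_E⁄ℂ]` in the space of rational forms. -/
def regularForms (d : ℕ) (E : DivisorOver A K) : Submodule E.ring (⋀[K]^d (Ω[K⁄ℂ])) :=
  Submodule.span E.ring (Set.range fun b : Fin d → E.ring =>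
    exteriorPower.ιMulti K d fun i => KaehlerDifferential.D ℂ K (b i : K))

/-- The order along `E` of a rational form `ω ≠ 0` of top degree: the largest `e` such that
`ω = c • η` with `ord_E c = e` and `η` regular at the generic point of `E`. -/
def ordForm (ω : ⋀[K]^d (Ω[K⁄ℂ])) (E : DivisorOver A K) : ℤ :=
  sSup {e : ℤ | ∃ c : K, c ≠ 0 ∧ E.ord c = e ∧ ∃ η ∈ regularForms d E, ω = c • η}

/-- The canonical divisor `K_X = div ω` on `X`. -/
def canonicalDivisor (ω : ⋀[K]^d (Ω[K⁄ℂ])) (P : PrimeDivisor A K) : ℤ := ordForm ω P.1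

/-- The discrepancy `a(E, X)`: the coefficient at `E` of `K_Y - φ^* K_X`, for `φ : Y → X` a normal
birational model on which `E` is a divisor, where `K_Y = div ω` and `K_X = div ω`. -/
def discrepancy (ω : ⋀[K]^d (Ω[K⁄ℂ])) (E : DivisorOver A K) : ℚ :=
  ordForm ω E - pullbackOrd (canonicalDivisor ω) E

/-- `E` is a non log canonical singularity of the pair `(X, (1/n) D)`. -/
def IsNonLCSingularity (ω : ⋀[K]^d (Ω[K⁄ℂ])) (n : ℕ) (D : PrimeDivisor A K → ℤ)
    (E : DivisorOver A K) : Prop :=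
  n * (discrepancy ω E + 1) < pullbackOrd D E

/-- The pair `(X, (1/n) D)` is canonical outside the closed point `o`: no exceptional divisor over
`X` with centre different from `o` is a non canonical singularity. -/
def IsCanonicalOutside [IsLocalRing A] (ω : ⋀[K]^d (Ω[K⁄ℂ])) (n : ℕ) (D : PrimeDivisor A K → ℤ) :
    Prop :=
  ∀ E : DivisorOver A K, 2 ≤ E.center.height → E.center ≠ maximalIdeal A →
    pullbackOrd D E ≤ n * discrepancy ω E

end Discrepancy

end Divisors

section Blowup

variable (A K : Type*) [CommRing A] [IsLocalRing A] [Field K] [Algebra A K]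

/-- The coordinate ring `A[𝔪/x] ⊆ K` of the affine chart of the blow up of the closed point that is
given by `x ∈ 𝔪`. The blow up `X⁺` is glued from the spectra of these rings, for `0 ≠ x ∈ 𝔪`. -/
def blowupChart (x : A) : Subalgebra A K :=
  Algebra.adjoin A {z | ∃ a ∈ maximalIdeal A, z = algebraMap A K a / algebraMap A K x}

variable {A K} in
/-- `R ⊆ K` is the local ring of a point of `X⁺`: the localization of a chart at a prime ideal. -/
def IsBlowupLocalRing (R : Subalgebra A K) : Prop :=
  ∃ x ∈ maximalIdeal A, algebraMap A K x ≠ 0 ∧ ∃ p : Ideal (blowupChart A K x), p.IsPrime ∧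
    ∀ z : K, z ∈ R ↔ ∃ a b : blowupChart A K x, b ∉ p ∧ z = a / b

/-- The (not necessarily closed) points of the blow up `X⁺` of the closed point `o` of `X`. -/
structure BlowupPoint where
  /-- The local ring of `X⁺` at the point. -/
  ring : Subalgebra A K
  isBlowupLocalRing : IsBlowupLocalRing ring

/-- The prime divisors on `X⁺`. -/
abbrev BlowupDivisor : Type _ := {P : DivisorOver A K // IsBlowupLocalRing P.ring}

variable {A K}

namespace BlowupPoint

variable (w : BlowupPoint A K)

instance : IsLocalRing w.ring := by
  obtain ⟨x, -, -, p, hp, h⟩ := w.isBlowupLocalRing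
  have key : ∀ z : w.ring, ∀ a b : blowupChart A K x, a ∉ p → b ∉ p → (z : K) = a / b →
      IsUnit z := by
    intro z a b ha hb hz
    have ha0 : (a : K) ≠ 0 := fun h0 => ha (by
      have : a = 0 := Subtype.ext h0
      rw [this]; exact p.zero_mem)
    have hb0 : (b : K) ≠ 0 := fun h0 => hb (by
      have : b = 0 := Subtype.ext h0
      rw [this]; exact p.zero_mem)
    refine IsUnit.of_mul_eq_one ⟨(b : K) / a, (h _).2 ⟨b, a, ha, rfl⟩⟩ (Subtype.ext ?_)
    change (z : K) * ((b : K) / a) = 1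
    rw [hz]; field_simp
  refine IsLocalRing.of_is_unit_or_is_unit_of_add_one fun {s t} hst => ?_
  obtain ⟨a, b, hb, hs⟩ := (h s).1 s.2
  obtain ⟨c, e, he, ht⟩ := (h t).1 t.2
  by_cases ha : a ∈ p
  · by_cases hc : c ∈ p
    · exfalso
      have hb0 : (b : K) ≠ 0 := fun h0 => hb (by
        have : b = 0 := Subtype.ext h0
        rw [this]; exact p.zero_mem)
      have he0 : (e : K) ≠ 0 := fun h0 => he (by
        have : e = 0 := Subtype.ext h0
        rw [this]; exact p.zero_mem)
      have h1 : (s : K) + t = 1 := congrArg Subtype.val hst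
      rw [hs, ht] at h1
      have h2 : a * e + b * c = b * e := Subtype.ext (by
        change (a : K) * e + b * c = b * e
        field_simp at h1
        linear_combination h1)
      have h3 : b * e ∈ p := h2 ▸ p.add_mem (p.mul_mem_right _ ha) (p.mul_mem_left _ hc)
      exact (hp.mem_or_mem h3).elim hb he
    · exact Or.inr (key t c e hc he ht)
  · exact Or.inl (key s a b ha hb hs)

/-- The point lies on the exceptional fibre over `o`. -/
def LiesOverClosedPoint : Prop :=
  (maximalIdeal w.ring).comap (algebraMap A w.ring) = maximalIdeal A

/-- The ideal `𝔪 𝒪_{X⁺,w}` of the scheme-theoretic fibre of `X⁺ → X` over `o`; the local ring of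
this fibre at `w` is the quotient by it. -/
def fibreIdeal : Ideal w.ring := (maximalIdeal A).map (algebraMap A w.ring)

/-- `w` is (the generic point of) the centre of `E` on `X⁺`: `𝒪_E` dominates `𝒪_{X⁺,w}`. -/
def IsCenterOf (E : DivisorOver A K) : Prop :=
  ∃ h : w.ring ≤ E.ring, IsLocalHom (Subalgebra.inclusion h)

/-- The closure of `w` is a prime divisor of the exceptional fibre. -/
def IsPrimeDivisorOfFibre : Prop :=
  w.LiesOverClosedPoint ∧ ringKrullDim (w.ring ⧸ w.fibreIdeal) = 1

end BlowupPoint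

variable [IsFractionRing A K]

/-- The exceptional fibre `𝒬 = φ⁻¹(o)` is irreducible with generic point `Q`, reduced and
non-singular in codimension one, and `a(𝒬, X) = 1`. -/
structure ConditionG [Algebra ℂ K] {d : ℕ} (ω : ⋀[K]^d (Ω[K⁄ℂ])) (Q : BlowupDivisor A K) :
    Prop where
  center_eq : Q.1.center = maximalIdeal A
  irreducible : ∀ w : BlowupPoint A K, w.LiesOverClosedPoint → w.ring ≤ Q.1.ring
  reduced : ∀ w : BlowupPoint A K, w.LiesOverClosedPoint → w.fibreIdeal.IsRadical
  regular : ∀ w : BlowupPoint A K, w.LiesOverClosedPoint →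
    ringKrullDim (w.ring ⧸ w.fibreIdeal) ≤ 1 → IsRegularLocalRing (w.ring ⧸ w.fibreIdeal)
  discrepancy_eq : discrepancy ω Q.1 = 1

open Classical in
/-- The strict transform `D⁺` on `X⁺` of a divisor `D` on `X`. -/
def strictTransform (D : PrimeDivisor A K →₀ ℕ) (P : BlowupDivisor A K) : ℤ :=
  if h : P.1.center.height = 1 then D ⟨P.1, h⟩ else 0

open Classical in
/-- The prime divisor `Q`, as a Weil divisor on `X⁺`. -/
def primeAsDivisor (Q P : BlowupDivisor A K) : ℤ := if P = Q then 1 else 0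

/-- Linear equivalence of Weil divisors on `X⁺`. -/
def LinEquiv (D₁ D₂ : BlowupDivisor A K → ℤ) : Prop :=
  ∃ g : K, g ≠ 0 ∧ ∀ P, D₁ P - D₂ P = P.1.ord g

/-- The ideal in `𝒪_{X⁺,w}` of the subscheme `D⁺ ⊆ X⁺`: the functions that vanish to order at least
`D P` along every component `P` of `D⁺` through `w`. -/
def BlowupPoint.strictTransformIdeal (w : BlowupPoint A K) (D : PrimeDivisor A K →₀ ℕ) :
    Ideal w.ring :=
  ⨅ (P : PrimeDivisor A K) (h : w.ring ≤ P.1.ring),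
    (maximalIdeal P.1.ring ^ D P).comap (Subalgebra.inclusion h)

/-- The ideal in `𝒪_{X⁺,w}` of the scheme-theoretic intersection `(D⁺ ∘ 𝒬)`. -/
def BlowupPoint.intersectionIdeal (w : BlowupPoint A K) (D : PrimeDivisor A K →₀ ℕ) :
    Ideal w.ring :=
  w.strictTransformIdeal D ⊔ w.fibreIdeal

/-- The multiplicity with which the closure `W` of `w` enters the scheme-theoretic intersection
`(D⁺ ∘ 𝒬)`: the length at `w` of the structure sheaf of this intersection. -/
def BlowupPoint.intersectionMultiplicity (w : BlowupPoint A K) (D : PrimeDivisor A K →₀ ℕ) : ℕ∞ :=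
  colength (w.intersectionIdeal D)

/-- The multiplicity `mult_W D⁺` of `D⁺` along the closure `W` of `w`, at whose generic point `X⁺` is
non-singular: the largest `k` such that the equation of `D⁺` lies in the `k`-th power of the
maximal ideal of `𝒪_{X⁺,w}`. -/
def BlowupPoint.multAlong (w : BlowupPoint A K) (D : PrimeDivisor A K →₀ ℕ) : ℕ∞ :=
  ⨆ (k : ℕ) (_ : w.strictTransformIdeal D ≤ maximalIdeal w.ring ^ k), (k : ℕ∞)

end Blowup

end SingGerm

end

/-! Everything happens in the local ring `R` of `X⁺` at the generic point of `W`. The fibre has a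
local equation `x` there and is regular in codimension one, so the maximal ideal of `R` is generated
by two parameters `x, y`. Write `v = ord_E`, let `f` be the equation of `D⁺`, and put `T = a(E, X⁺)
+ 1` and `L = T - v x`, the log discrepancies of `E` over `X⁺` and over the pair `(X⁺, Q)`. As `a(Q,
X) = 1`, one has `a(E, X) = a(E, X⁺) + v x` (`discrepancy_eq`), and the hypothesis on `E` becomes `n
(T + v x) < ν v x + v f`.

Two bounds suffice: `v f ≤ μ L`, with `μ` the multiplicity of `W` in `D⁺ ∘ Q`, and `v f ≤ m T`, with
`m = mult_W D⁺`. As `ν ≤ 2n`, the first gives `n L < μ L`, hence `μ > n` because `L ≥ 0`; if `ν ≥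
n`, the second together with `L ≥ 0` gives `m > 2n - ν`.

The bounds replace inversion of adjunction by differentiation in characteristic zero. The form `df`
has order at least `v f - 1` along `E`, so `v f ≤ v (∂f) + T` for each partial derivative. The form
`dx ∧ df` has order at least `v x + v f - 1`, since two logarithmic forms share a single pole
(`ιMulti_eq_smul_of_D_of_D`); this gives `v f ≤ v (∂f/∂y) + L`. Suitable derivatives lower the
multiplicity by at most one, and units have `v = 0`, so iteration yields both bounds
(`le_mul_of_notMem_span_pow`, `le_mul_of_notMem_pow`).

Two foundations are needed: `Ω[R⁄ℂ]` is free on `d` exact differentials starting with `dx, dy`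
(`exists_span_D_eq_top`, `exists_basis_and_derivation`), and functions regular along every prime
divisor through `w` lie in `R` (`mem_ring_of_forall_ord_nonneg`). -/

noncomputable section

namespace SingGerm

/-! ### Orders along a divisor over the germ. -/

namespace DivisorOver

variable {A K : Type*} [CommRing A] [Field K] [Algebra A K]
variable (E : DivisorOver A K)

lemma mem_maximalIdeal_iff {v : E.ring} : v ∈ maximalIdeal E.ring ↔ (v : K)⁻¹ ∉ E.ring ∨ v = 0 := by
  rcases eq_or_ne v 0 with rfl | hv
  · simp
  have hv' : (v : K) ≠ 0 := fun h => hv (Subtype.ext h)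
  rw [mem_maximalIdeal, mem_nonunits_iff]
  simp only [hv, or_false, not_iff_not]
  refine ⟨fun h => ?_, fun h => IsUnit.of_mul_eq_one ⟨_, h⟩ (Subtype.ext (mul_inv_cancel₀ hv'))⟩
  obtain ⟨u, hu⟩ := h.exists_right_inv
  have : (v : K) * u = 1 := congrArg Subtype.val hu
  rw [← eq_inv_of_mul_eq_one_right this]
  exact u.2

variable [IsFractionRing A K]

lemma ordFrac_ne_zero {z : K} (hz : z ≠ 0) : Ring.ordFrac E.ring z ≠ 0 :=
  (map_ne_zero _).2 hz

lemma ord_mul {a b : K} (ha : a ≠ 0) (hb : b ≠ 0) : E.ord (a * b) = E.ord a + E.ord b := by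
  unfold ord
  rw [map_mul, WithZero.log_mul (E.ordFrac_ne_zero ha) (E.ordFrac_ne_zero hb)]

lemma ord_one : E.ord 1 = 0 := by simp [ord]

lemma ord_inv (a : K) : E.ord a⁻¹ = -E.ord a := by
  unfold ord
  rw [map_inv₀, WithZero.log_inv]

lemma ord_div {a b : K} (ha : a ≠ 0) (hb : b ≠ 0) : E.ord (a / b) = E.ord a - E.ord b := by
  rw [div_eq_mul_inv, E.ord_mul ha (inv_ne_zero hb), ord_inv, sub_eq_add_neg]

lemma ord_pow (a : K) (n : ℕ) : E.ord (a ^ n) = n * E.ord a := by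
  unfold ord
  rw [map_pow, WithZero.log_pow, nsmul_eq_mul]

lemma ord_zpow (a : K) (n : ℤ) : E.ord (a ^ n) = n * E.ord a := by
  unfold ord
  rw [map_zpow₀, WithZero.log_zpow, zsmul_eq_mul, Int.cast_id]

lemma ord_eq_zero_of_mem {z : K} (h : z ∈ E.ring) (h' : z⁻¹ ∈ E.ring) : E.ord z = 0 := by
  rcases eq_or_ne z 0 with rfl | hz
  · simp [ord]
  have hu : IsUnit (⟨z, h⟩ : E.ring) :=
    IsUnit.of_mul_eq_one ⟨z⁻¹, h'⟩ (Subtype.ext (mul_inv_cancel₀ hz))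
  have := Ring.ordFrac_of_isUnit (K := K) hu
  unfold ord
  rw [show z = algebraMap E.ring K ⟨z, h⟩ from rfl, this, WithZero.log_one]

lemma exists_uniformizer : ∃ t : K, t ≠ 0 ∧ t ∈ E.ring ∧ E.ord t = 1 := by
  obtain ⟨t, ht⟩ := IsDiscreteValuationRing.exists_irreducible E.ring
  refine ⟨t, fun h => ht.ne_zero (Subtype.ext h), t.2, ?_⟩
  unfold ord
  rw [show (t : K) = algebraMap E.ring K t from rfl, Ring.ordFrac_irreducible ht, WithZero.log_exp]

lemma ord_nonneg_of_mem {z : K} (h : z ∈ E.ring) : 0 ≤ E.ord z := by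
  rcases eq_or_ne z 0 with rfl | hz
  · simp [ord]
  have := Ring.ordFrac_ge_one_of_ne_zero (K := K) (x := (⟨z, h⟩ : E.ring))
    (fun h0 => hz (congrArg Subtype.val h0))
  unfold ord
  rw [← WithZero.log_one]
  exact (WithZero.log_le_log one_ne_zero (E.ordFrac_ne_zero hz)).2 this

lemma mem_or_inv_mem (z : K) : z ∈ E.ring ∨ z⁻¹ ∈ E.ring := by
  rcases ValuationRing.isInteger_or_isInteger E.ring z with ⟨a, ha⟩ | ⟨a, ha⟩
  · exact Or.inl (ha ▸ a.2)
  · exact Or.inr (ha ▸ a.2)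

lemma inv_mem_of_ord_eq_zero {z : K} (h : z ∈ E.ring) (hz : z ≠ 0) (h0 : E.ord z = 0) :
    z⁻¹ ∈ E.ring := by
  have hu : IsUnit (⟨z, h⟩ : E.ring) := by
    rw [Ring.isUnit_iff_ordFrac_one_of_isDiscreteValuationRing (K := K)]
    have h1 : WithZero.log (Ring.ordFrac E.ring z) = 0 := h0
    rw [show algebraMap E.ring K ⟨z, h⟩ = z from rfl, ← WithZero.exp_log (E.ordFrac_ne_zero hz),
      h1, WithZero.exp_zero]
  obtain ⟨v, hv⟩ := hu.exists_right_inv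
  have : z * v = 1 := congrArg Subtype.val hv
  rw [← eq_inv_of_mul_eq_one_right this]
  exact v.2

lemma ord_nonneg_iff {z : K} (hz : z ≠ 0) : 0 ≤ E.ord z ↔ z ∈ E.ring := by
  refine ⟨fun h => ?_, E.ord_nonneg_of_mem⟩
  rcases E.mem_or_inv_mem z with h' | h'
  · exact h'
  have h1 := E.ord_nonneg_of_mem h'
  rw [ord_inv] at h1
  have := E.inv_mem_of_ord_eq_zero h' (inv_ne_zero hz) (by rw [ord_inv]; omega)
  rwa [inv_inv] at this

lemma ord_eq_zero_iff {z : K} (hz : z ≠ 0) : E.ord z = 0 ↔ z ∈ E.ring ∧ z⁻¹ ∈ E.ring :=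
  ⟨fun h => ⟨(E.ord_nonneg_iff hz).1 h.ge,
    E.inv_mem_of_ord_eq_zero ((E.ord_nonneg_iff hz).1 h.ge) hz h⟩,
    fun h => E.ord_eq_zero_of_mem h.1 h.2⟩

lemma mem_maximalIdeal_iff_ord {v : E.ring} (hv : (v : K) ≠ 0) :
    v ∈ maximalIdeal E.ring ↔ 1 ≤ E.ord v := by
  rw [mem_maximalIdeal_iff]
  have h0 : v ≠ 0 := fun h => hv (by rw [h]; rfl)
  have h1 := E.ord_nonneg_of_mem v.2
  have h2 := E.ord_eq_zero_iff hv
  simp only [v.2, true_and] at h2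
  simp only [h0, or_false, ← h2]
  omega

lemma mem_maximalIdeal_pow_iff {v : E.ring} (hv : (v : K) ≠ 0) (n : ℕ) :
    v ∈ maximalIdeal E.ring ^ n ↔ (n : ℤ) ≤ E.ord v := by
  obtain ⟨t, ht0, ht, ht1⟩ := E.exists_uniformizer
  have key : maximalIdeal E.ring = Ideal.span {⟨t, ht⟩} := by
    refine le_antisymm (fun z hz => ?_) ?_
    · rcases eq_or_ne z 0 with rfl | hz0
      · exact zero_mem _
      have hz0' : (z : K) ≠ 0 := fun h => hz0 (Subtype.ext h)
      rw [mem_maximalIdeal_iff_ord _ hz0'] at hz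
      rw [Ideal.mem_span_singleton']
      refine ⟨⟨z / t, (E.ord_nonneg_iff (div_ne_zero hz0' ht0)).1 ?_⟩, Subtype.ext ?_⟩
      · rw [E.ord_div hz0' ht0]; omega
      · exact div_mul_cancel₀ _ ht0
    · rw [Ideal.span_singleton_le_iff_mem, mem_maximalIdeal_iff_ord _ ht0]
      exact ht1.ge
  rw [key, Ideal.span_singleton_pow, Ideal.mem_span_singleton']
  constructor
  · rintro ⟨a, ha⟩
    have h1 : (a : K) * t ^ n = v := congrArg Subtype.val ha
    have ha0 : (a : K) ≠ 0 := fun h => hv (by rw [← h1, h, zero_mul])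
    rw [← h1, E.ord_mul ha0 (pow_ne_zero _ ht0), ord_pow, ht1]
    have := E.ord_nonneg_of_mem a.2
    omega
  · intro h
    refine ⟨⟨v / t ^ n, (E.ord_nonneg_iff (div_ne_zero hv (pow_ne_zero _ ht0))).1 ?_⟩,
      Subtype.ext ?_⟩
    · rw [E.ord_div hv (pow_ne_zero _ ht0), ord_pow, ht1]; omega
    · exact div_mul_cancel₀ _ (pow_ne_zero _ ht0)

lemma mem_center_iff {a : A} (ha : a ≠ 0) :
    a ∈ E.center ↔ (algebraMap A K a)⁻¹ ∉ E.ring := by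
  have h0 : algebraMap A K a ≠ 0 := by
    simpa using ha
  unfold center
  rw [Ideal.mem_comap, mem_maximalIdeal_iff]
  have : algebraMap A E.ring a ≠ 0 := fun h => h0 (congrArg Subtype.val h)
  simp only [this, or_false]
  rfl

instance : E.center.IsPrime := by
  unfold center; infer_instance

end DivisorOver

/-! ### Orders of differential forms along a divisor. -/

section Forms

variable {A K : Type*} [CommRing A] [Field K] [Algebra A K] [Algebra ℂ K]

/-- The lattice of regular differentials at the generic point of `E` in the space of rational
differentials. -/
def regularDifferentials (E : DivisorOver A K) : Submodule E.ring (Ω[K⁄ℂ]) :=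
  Submodule.span E.ring (Set.range fun b : E.ring => KaehlerDifferential.D ℂ K (b : K))

variable {d : ℕ} (E : DivisorOver A K)

lemma D_mem_regularDifferentials {a : K} (ha : a ∈ E.ring) :
    KaehlerDifferential.D ℂ K a ∈ regularDifferentials E :=
  Submodule.subset_span ⟨⟨a, ha⟩, rfl⟩

lemma smul_mem_regularDifferentials {a : K} (ha : a ∈ E.ring) {η : Ω[K⁄ℂ]}
    (hη : η ∈ regularDifferentials E) : a • η ∈ regularDifferentials E :=
  (regularDifferentials E).smul_mem (⟨a, ha⟩ : E.ring) hη

/-- Only wedges of exact differentials generate `regularForms` by definition. Multilinearity extends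
this to arbitrary regular differentials one slot at a time; `s` holds the slots not yet known to be
exact. -/
lemma ιMulti_mem_regularForms {w : Fin d → Ω[K⁄ℂ]} (h : ∀ i, w i ∈ regularDifferentials E) :
    exteriorPower.ιMulti K d w ∈ regularForms d E := by
  suffices H : ∀ (s : Finset (Fin d)) (w : Fin d → Ω[K⁄ℂ]),
      (∀ i ∈ s, w i ∈ regularDifferentials E) →
      (∀ i ∉ s, ∃ b : E.ring, KaehlerDifferential.D ℂ K (b : K) = w i) →
      exteriorPower.ιMulti K d w ∈ regularForms d E from
    H Finset.univ w (fun i _ => h i) (fun i hi => absurd (Finset.mem_univ i) hi)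
  intro s
  induction s using Finset.induction_on with
  | empty =>
    intro w _ h
    choose b hb using fun i => h i (Finset.notMem_empty i)
    exact Submodule.subset_span ⟨b, by simp only [hb]⟩
  | insert i s hi ih =>
    intro w h1 h2
    have key : ∀ z ∈ regularDifferentials E,
        exteriorPower.ιMulti K d (Function.update w i z) ∈ regularForms d E := by
      intro z hz
      induction hz using Submodule.span_induction with
      | mem z hz =>
        refine ih _ (fun j hj => ?_) (fun j hj => ?_)
        · rw [Function.update_of_ne (ne_of_mem_of_not_mem hj hi)]
          exact h1 j (Finset.mem_insert_of_mem hj)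
        · rcases eq_or_ne j i with rfl | hji
          · rw [Function.update_self]; exact hz
          · rw [Function.update_of_ne hji]
            exact h2 j (by simp [hji, hj])
      | zero => rw [AlternatingMap.map_update_zero]; exact zero_mem _
      | add a b _ _ ha hb => rw [AlternatingMap.map_update_add]; exact add_mem ha hb
      | smul c a _ ha =>
        rw [show c • a = (c : K) • a from rfl, AlternatingMap.map_update_smul]
        exact (regularForms d E).smul_mem c ha
    simpa using key (w i) (h1 i (Finset.mem_insert_self _ _))

lemma ιMulti_eq_det_smul (b : Module.Basis (Fin d) K (Ω[K⁄ℂ])) (v : Fin d → Ω[K⁄ℂ]) :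
    exteriorPower.ιMulti K d v = b.det v • exteriorPower.ιMulti K d b := by
  have : exteriorPower.ιMulti K d =
      (LinearMap.toSpanSingleton K _ (exteriorPower.ιMulti K d b)).compAlternatingMap b.det := by
    refine b.ext_alternating fun w hw => ?_
    obtain ⟨σ, hσ⟩ : ∃ σ : Equiv.Perm (Fin d), w = σ :=
      ⟨Equiv.ofBijective w (Finite.injective_iff_bijective.1 hw), rfl⟩
    subst hσ
    change exteriorPower.ιMulti K d (b ∘ σ) = b.det (b ∘ σ) • exteriorPower.ιMulti K d b
    rw [AlternatingMap.map_perm, AlternatingMap.map_perm, b.det_self]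
    simp
  exact congrFun (congrArg DFunLike.coe this) v

lemma ιMulti_basis_ne_zero (b : Module.Basis (Fin d) K (Ω[K⁄ℂ])) {ω : ⋀[K]^d (Ω[K⁄ℂ])}
    (hω : ω ≠ 0) :
    exteriorPower.ιMulti K d b ≠ 0 := by
  intro h
  have : Submodule.span K (Set.range (exteriorPower.ιMulti K d (M := Ω[K⁄ℂ]))) = ⊥ := by
    rw [Submodule.span_eq_bot]
    rintro _ ⟨v, rfl⟩
    rw [ιMulti_eq_det_smul b, h, smul_zero]
  rw [exteriorPower.ιMulti_span] at this
  exact hω ((Submodule.mem_bot K).1 (this ▸ Submodule.mem_top))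

lemma exists_eq_smul_ιMulti_basis (b : Module.Basis (Fin d) K (Ω[K⁄ℂ])) (ω : ⋀[K]^d (Ω[K⁄ℂ])) :
    ∃ c : K, ω = c • exteriorPower.ιMulti K d b := by
  have : ω ∈ Submodule.span K (Set.range (exteriorPower.ιMulti K d (M := Ω[K⁄ℂ]))) := by
    rw [exteriorPower.ιMulti_span]; exact Submodule.mem_top
  induction this using Submodule.span_induction with
  | mem z hz => obtain ⟨v, rfl⟩ := hz; exact ⟨_, ιMulti_eq_det_smul b v⟩
  | zero => exact ⟨0, (zero_smul _ _).symm⟩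
  | add x y _ _ hx hy =>
    obtain ⟨c, hc⟩ := hx; obtain ⟨e, he⟩ := hy
    exact ⟨c + e, by rw [add_smul, ← hc, ← he]⟩
  | smul a x _ hx =>
    obtain ⟨c, hc⟩ := hx
    exact ⟨a * c, by rw [mul_smul, ← hc]⟩

lemma regularForms_le_of_regularDifferentials_le (b : Module.Basis (Fin d) K (Ω[K⁄ℂ]))
    (h : ∀ η ∈ regularDifferentials E, ∀ i, b.repr η i ∈ E.ring) {η : ⋀[K]^d (Ω[K⁄ℂ])}
    (hη : η ∈ regularForms d E) : ∃ v ∈ E.ring, η = v • exteriorPower.ιMulti K d b := by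
  induction hη using Submodule.span_induction with
  | mem z hz =>
    obtain ⟨v, rfl⟩ := hz
    refine ⟨_, ?_, ιMulti_eq_det_smul b _⟩
    rw [Module.Basis.det_apply, Matrix.det_apply]
    refine sum_mem fun σ _ => ?_
    rw [Units.smul_def]
    exact zsmul_mem (prod_mem fun i _ => h _ (D_mem_regularDifferentials E (v _).2) _) _
  | zero => exact ⟨0, zero_mem _, (zero_smul _ _).symm⟩
  | add x y _ _ hx hy =>
    obtain ⟨c, hc, hc'⟩ := hx; obtain ⟨e, he, he'⟩ := hy
    exact ⟨c + e, add_mem hc he, by rw [add_smul, ← hc', ← he']⟩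
  | smul a x _ hx =>
    obtain ⟨c, hc, hc'⟩ := hx
    exact ⟨a * c, mul_mem a.2 hc, by rw [mul_smul, ← hc']; rfl⟩

variable [IsFractionRing A K]

/-- Leibniz applied to `a = u t ^ k` with `u` a unit. The exponent `k - 1` is an integer because `k
= 0` is allowed; then the `dt` term vanishes and the factor `t` in front of `du` compensates. -/
lemma D_eq_smul {t a : K} (ht0 : t ≠ 0) (ht1 : E.ord t = 1) (ha : a ∈ E.ring)
    (ha0 : a ≠ 0) : ∃ u : K, u ≠ 0 ∧ u ∈ E.ring ∧ u⁻¹ ∈ E.ring ∧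
      KaehlerDifferential.D ℂ K a = t ^ (E.ord a - 1) •
        (((E.ord a : K) * u) • KaehlerDifferential.D ℂ K t + t • KaehlerDifferential.D ℂ K u) := by
  obtain ⟨k, hk⟩ := Int.eq_ofNat_of_zero_le (E.ord_nonneg_of_mem ha)
  have hp := pow_ne_zero k ht0
  have hu : E.ord (a / t ^ k) = 0 := by
    rw [E.ord_div ha0 hp, E.ord_pow, hk, ht1]; simp
  have h := (E.ord_eq_zero_iff (div_ne_zero ha0 hp)).1 hu
  refine ⟨a / t ^ k, div_ne_zero ha0 hp, h.1, h.2, ?_⟩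
  set u := a / t ^ k with hu
  have hau : a = u * t ^ k := by rw [hu, div_mul_cancel₀ _ hp]
  conv_lhs => rw [hau, Derivation.leibniz, Derivation.leibniz_pow]
  rw [hk, smul_add, smul_smul, smul_smul, zpow_sub_one₀ ht0, ← Nat.cast_smul_eq_nsmul K, smul_smul,
    smul_smul]
  congr 2
  · rcases k with _ | k
    · simp
    · push_cast
      rw [zpow_add_one₀ ht0]
      field_simp
      simp [mul_comm]
  · rw [mul_assoc, inv_mul_cancel₀ ht0, mul_one]
    simp

lemma ιMulti_eq_smul_of_D {w : Fin d → Ω[K⁄ℂ]} {i : Fin d} {a : K} (ha : a ∈ E.ring) (ha0 : a ≠ 0)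
    (hi : w i = KaehlerDifferential.D ℂ K a) (hw : ∀ l, l ≠ i → w l ∈ regularDifferentials E) :
    ∃ c : K, c ≠ 0 ∧ E.ord c = E.ord a - 1 ∧ ∃ η ∈ regularForms d E,
      exteriorPower.ιMulti K d w = c • η := by
  obtain ⟨t, ht0, ht, ht1⟩ := E.exists_uniformizer
  obtain ⟨u, -, hu, -, h⟩ := D_eq_smul (K := K) E ht0 ht1 ha ha0
  refine ⟨t ^ (E.ord a - 1), zpow_ne_zero _ ht0, by rw [E.ord_zpow, ht1, mul_one], _, ?_,
    by rw [← Function.update_eq_self i w, hi, h, AlternatingMap.map_update_smul]⟩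
  refine ιMulti_mem_regularForms E fun j => ?_
  rcases eq_or_ne j i with rfl | hji
  · rw [Function.update_self]
    exact add_mem (smul_mem_regularDifferentials E (mul_mem (intCast_mem _ _) hu)
      (D_mem_regularDifferentials E ht))
      (smul_mem_regularDifferentials E ht (D_mem_regularDifferentials E hu))
  · rw [Function.update_of_ne hji]; exact hw j hji

/-- Both `da / a` and `db / b` have at most a simple pole along `E`, with polar parts proportional
to `dt / t`. Their wedge therefore has at most a simple pole, which saves one order over treating
the two factors separately. -/
lemma ιMulti_eq_smul_of_D_of_D [Algebra ℂ A] [IsScalarTower ℂ A K] {w : Fin d → Ω[K⁄ℂ]}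
    {i j : Fin d} (hij : i ≠ j) {a b : K}
    (ha : a ∈ E.ring) (ha0 : a ≠ 0) (hb : b ∈ E.ring) (hb0 : b ≠ 0)
    (hi : w i = KaehlerDifferential.D ℂ K a) (hj : w j = KaehlerDifferential.D ℂ K b)
    (hw : ∀ l, w l ∈ regularDifferentials E) :
    ∃ c : K, c ≠ 0 ∧ E.ord c = E.ord a + E.ord b - 1 ∧ ∃ η ∈ regularForms d E,
      exteriorPower.ιMulti K d w = c • η := by
  -- If `b` is a unit, `db` has no logarithmic pole, and the bound for `da` alone is already the one
  -- claimed.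
  rcases eq_or_ne (E.ord b) 0 with hb1 | hb1
  · rw [hb1, add_zero]
    exact ιMulti_eq_smul_of_D E ha ha0 hi fun l _ => hw l
  obtain ⟨t, ht0, ht, ht1⟩ := E.exists_uniformizer
  obtain ⟨u, -, hu, -, h⟩ := D_eq_smul (K := K) E ht0 ht1 ha ha0
  obtain ⟨v, hv0, hv, hv', h'⟩ := D_eq_smul (K := K) E ht0 ht1 hb hb0
  have : CharZero K := charZero_of_injective_algebraMap (algebraMap ℂ K).injective
  have hz : ((E.ord b : ℤ) : K) ≠ 0 := Int.cast_ne_zero.2 hb1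
  have hz' : ((E.ord b : ℤ) : K)⁻¹ ∈ E.ring := by
    have : ((E.ord b : ℤ) : K)⁻¹ = algebraMap A K (algebraMap ℂ A ((E.ord b : ℤ) : ℂ)⁻¹) := by
      rw [← IsScalarTower.algebraMap_apply, map_inv₀, map_intCast]
    rw [this]
    exact E.ring.algebraMap_mem _
  set α := ((E.ord a : K) * u) • KaehlerDifferential.D ℂ K t + t • KaehlerDifferential.D ℂ K u
  set β := ((E.ord b : K) * v) • KaehlerDifferential.D ℂ K t + t • KaehlerDifferential.D ℂ K v
    with hβ
  have hβm : β ∈ regularDifferentials E :=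
    add_mem (smul_mem_regularDifferentials E (mul_mem (intCast_mem _ _) hv)
      (D_mem_regularDifferentials E ht))
      (smul_mem_regularDifferentials E ht (D_mem_regularDifferentials E hv))
  -- The ratio of the `dt` coefficients of `α` and `β`, regular because nonzero integers are units.
  -- Subtracting `c β` removes `dt` from `α` and leaves the multiple `t γ`, so that `α ∧ β = t γ ∧
  -- β`.
  set c : K := (E.ord a : K) * u * ((E.ord b : K)⁻¹ * v⁻¹) with hc
  have hcm : c ∈ E.ring := mul_mem (mul_mem (intCast_mem _ _) hu) (mul_mem hz' hv')
  set γ := KaehlerDifferential.D ℂ K u + (-c) • KaehlerDifferential.D ℂ K v with hγ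
  have hγm : γ ∈ regularDifferentials E :=
    add_mem (D_mem_regularDifferentials E hu)
      (smul_mem_regularDifferentials E (neg_mem hcm) (D_mem_regularDifferentials E hv))
  have hα : α = t • γ + c • β := by
    have h1 : c * ((E.ord b : K) * v) = (E.ord a : K) * u := by rw [hc]; field_simp
    rw [hγ, hβ, smul_add, smul_add, smul_smul, smul_smul c, smul_smul c, h1]
    simp only [α]
    module
  have hβ' : Function.update w j β j = β := Function.update_self ..
  have e1 : exteriorPower.ιMulti K d w = (t ^ (E.ord b - 1) * (t ^ (E.ord a - 1) * t)) •
      exteriorPower.ιMulti K d (Function.update (Function.update w j β) i γ) := by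
    have h2 : w = Function.update (Function.update w i (t ^ (E.ord a - 1) • α)) j
        (t ^ (E.ord b - 1) • β) := by
      rw [← h, ← h', ← hi, ← hj, Function.update_eq_self, Function.update_eq_self]
    conv_lhs => rw [h2, AlternatingMap.map_update_smul, Function.update_comm hij,
      AlternatingMap.map_update_smul, hα, AlternatingMap.map_update_add,
      AlternatingMap.map_update_smul, AlternatingMap.map_update_smul]
    have e2 := AlternatingMap.map_update_self (exteriorPower.ιMulti K d)
      (Function.update w j β) hij
    rw [hβ'] at e2
    rw [e2]
    simp only [smul_zero, add_zero, smul_smul]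
  refine ⟨_, ?_, ?_, _, ?_, e1⟩
  · exact mul_ne_zero (zpow_ne_zero _ ht0) (mul_ne_zero (zpow_ne_zero _ ht0) ht0)
  · rw [E.ord_mul (zpow_ne_zero _ ht0) (mul_ne_zero (zpow_ne_zero _ ht0) ht0),
      E.ord_mul (zpow_ne_zero _ ht0) ht0, E.ord_zpow, E.ord_zpow, ht1]
    ring
  · refine ιMulti_mem_regularForms E fun l => ?_
    rcases eq_or_ne l i with rfl | hli
    · rw [Function.update_self]; exact hγm
    rw [Function.update_of_ne hli]
    rcases eq_or_ne l j with rfl | hlj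
    · rw [Function.update_self]; exact hβm
    · rw [Function.update_of_ne hlj]; exact hw l

/-- Over a lattice generated by a basis, the order of a form is that of its coefficient. -/
lemma ord_le_of_eq_smul (b : Module.Basis (Fin d) K (Ω[K⁄ℂ]))
    (h : ∀ η ∈ regularDifferentials E, ∀ i, b.repr η i ∈ E.ring) {ω : ⋀[K]^d (Ω[K⁄ℂ])}
    {c e : K} (hω : ω ≠ 0) (hc : ω = c • exteriorPower.ιMulti K d b) {η : ⋀[K]^d (Ω[K⁄ℂ])}
    (hη : η ∈ regularForms d E) (he : ω = e • η) : E.ord e ≤ E.ord c := by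
  obtain ⟨v, hv, rfl⟩ := regularForms_le_of_regularDifferentials_le E b h hη
  rw [he, smul_smul] at hc
  have hcv : e * v = c := smul_left_injective K (ιMulti_basis_ne_zero b hω) hc
  have he0 : e ≠ 0 := by rintro rfl; exact hω (by rw [he, zero_smul])
  have hv0 : v ≠ 0 := by rintro rfl; exact hω (by rw [he, zero_smul, smul_zero])
  rw [← hcv, E.ord_mul he0 hv0]
  have := E.ord_nonneg_of_mem hv
  omega

lemma ordForm_eq_ord (b : Module.Basis (Fin d) K (Ω[K⁄ℂ]))
    (h : ∀ η ∈ regularDifferentials E, ∀ i, b.repr η i ∈ E.ring)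
    (hb : ∀ i, b i ∈ regularDifferentials E) {ω : ⋀[K]^d (Ω[K⁄ℂ])}
    {c : K} (hω : ω ≠ 0) (hc : ω = c • exteriorPower.ιMulti K d b) : ordForm ω E = E.ord c := by
  refine IsGreatest.csSup_eq ⟨⟨c, ?_, rfl, _, ιMulti_mem_regularForms E hb, hc⟩, ?_⟩
  · rintro rfl; exact hω (by rw [hc, zero_smul])
  · rintro _ ⟨e, -, rfl, η, hη, he⟩
    exact ord_le_of_eq_smul E b h hω hc hη he

/-- Differentials of a ring essentially of finite type are finitely generated, so one power of a
uniformizer clears all denominators. This bounds the set whose supremum defines `ordForm`; an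
unbounded set of integers would have the default supremum `0`. -/
lemma exists_basis_repr_mem [Algebra ℂ A] [IsScalarTower ℂ A K] [Algebra.EssFiniteType ℂ E.ring]
    (b : Module.Basis (Fin d) K (Ω[K⁄ℂ])) : ∃ b' : Module.Basis (Fin d) K (Ω[K⁄ℂ]),
      ∀ η ∈ regularDifferentials E, ∀ i, b'.repr η i ∈ E.ring := by
  obtain ⟨t, ht0, ht, ht1⟩ := E.exists_uniformizer
  have hfin : ∃ s : Finset (Ω[K⁄ℂ]), regularDifferentials E ≤ Submodule.span E.ring s := by
    obtain ⟨s, hs⟩ := (Module.Finite.fg_top : (⊤ : Submodule E.ring (Ω[E.ring⁄ℂ])).FG)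
    classical
    refine ⟨s.image (KaehlerDifferential.map ℂ ℂ E.ring K), Submodule.span_le.2 ?_⟩
    rintro _ ⟨v, rfl⟩
    have := Submodule.mem_map_of_mem (f := KaehlerDifferential.map ℂ ℂ E.ring K)
      (hs.ge (Submodule.mem_top (x := KaehlerDifferential.D ℂ E.ring v)))
    rw [Submodule.map_span, KaehlerDifferential.map_D] at this
    rw [Finset.coe_image]
    exact this
  obtain ⟨s, hs⟩ := hfin
  have hN : ∃ N : ℕ, ∀ η ∈ s, ∀ i, t ^ N * b.repr η i ∈ E.ring := by
    refine ⟨∑ η ∈ s, ∑ i, (E.ord (b.repr η i)).natAbs, fun η hη i => ?_⟩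
    rcases eq_or_ne (b.repr η i) 0 with h0 | h0
    · rw [h0, mul_zero]; exact zero_mem _
    rw [← E.ord_nonneg_iff (mul_ne_zero (pow_ne_zero _ ht0) h0),
      E.ord_mul (pow_ne_zero _ ht0) h0, E.ord_pow, ht1]
    have h1 : (E.ord (b.repr η i)).natAbs ≤ ∑ η ∈ s, ∑ i, (E.ord (b.repr η i)).natAbs :=
      (Finset.single_le_sum (f := fun i => (E.ord (b.repr η i)).natAbs) (fun _ _ => Nat.zero_le _)
        (Finset.mem_univ i)).trans (Finset.single_le_sum
          (f := fun η => ∑ i, (E.ord (b.repr η i)).natAbs) (fun _ _ => Nat.zero_le _) hη)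
    omega
  obtain ⟨N, hN⟩ := hN
  have hu : IsUnit (t ^ N)⁻¹ := (isUnit_iff_ne_zero.2 (inv_ne_zero (pow_ne_zero _ ht0)))
  refine ⟨b.isUnitSMul fun _ => hu, fun η hη i => ?_⟩
  have hr : ∀ η, (b.isUnitSMul fun _ => hu).repr η i = t ^ N * b.repr η i := by
    intro η
    rw [Module.Basis.repr_isUnitSMul, Units.smul_def, smul_eq_mul]
    congr 1
    rw [Units.val_inv_eq_inv_val, IsUnit.unit_spec, inv_inv]
  rw [hr]
  replace hη := hs hη
  induction hη using Submodule.span_induction with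
  | mem z hz => exact hN z hz i
  | zero => simp
  | add x y _ _ hx hy =>
    rw [map_add, Finsupp.add_apply, mul_add]; exact add_mem hx hy
  | smul a x _ hx =>
    rw [show a • x = (a : K) • x from rfl, map_smul, Finsupp.smul_apply, smul_eq_mul,
      mul_left_comm]
    exact mul_mem a.2 hx

lemma ord_le_ordForm [Algebra ℂ A] [IsScalarTower ℂ A K] [Algebra.EssFiniteType ℂ E.ring]
    (b : Module.Basis (Fin d) K (Ω[K⁄ℂ])) {ω η : ⋀[K]^d (Ω[K⁄ℂ])} {c : K}
    (hω : ω ≠ 0) (hη : η ∈ regularForms d E) (hc : ω = c • η) : E.ord c ≤ ordForm ω E := by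
  obtain ⟨b', hb'⟩ := exists_basis_repr_mem E b
  obtain ⟨e, he⟩ := exists_eq_smul_ιMulti_basis b' ω
  refine le_csSup ⟨E.ord e, ?_⟩ ⟨c, ?_, rfl, η, hη, hc⟩
  · rintro _ ⟨c', -, rfl, η', hη', hc'⟩
    exact ord_le_of_eq_smul E b' hb' hω he hη' hc'
  · rintro rfl; exact hω (by rw [hc, zero_smul])

end Forms

/-! ### Transcendence degree and dimension. -/

section Dimension

lemma isMaximal_of_forall_sub_mem {k S : Type*} [Field k] [CommRing S] [Algebra k S] (p : Ideal S)
    (hp : p ≠ ⊤) (h : ∀ a : S, ∃ c : k, a - algebraMap k S c ∈ p) : p.IsMaximal := by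
  refine Ideal.isMaximal_iff.2 ⟨(Ideal.ne_top_iff_one p).1 hp, fun J x hJ hx hxJ => ?_⟩
  obtain ⟨c, hc⟩ := h x
  have hc0 : c ≠ 0 := by
    rintro rfl
    rw [map_zero, sub_zero] at hc
    exact hx hc
  have h1 : algebraMap k S c ∈ J := by
    have := J.sub_mem hxJ (hJ hc)
    rwa [sub_sub_cancel] at this
  have h2 := J.mul_mem_left (algebraMap k S c⁻¹) h1
  rwa [← map_mul, inv_mul_cancel₀ hc0, map_one] at h2

/-- A prime with residue field `k` is maximal, and its trace on the polynomials in one variable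
fewer again has residue field `k`. Each variable thus adds one to the height. -/
lemma natCast_le_height_of_forall_sub_mem {k : Type*} [Field k] {s : ℕ}
    (q : Ideal (MvPolynomial (Fin s) k)) [q.IsPrime]
    (h : ∀ a, ∃ c : k, a - algebraMap k _ c ∈ q) : (s : ℕ∞) ≤ q.height := by
  induction s with
  | zero => simp
  | succ s ih =>
    let e := MvPolynomial.finSuccEquiv k s
    let q' : Ideal (Polynomial (MvPolynomial (Fin s) k)) := q.comap e.symm.toRingEquiv
    have hq' : ∀ a, ∃ c : k, a - algebraMap k _ c ∈ q' := by
      intro a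
      obtain ⟨c, hc⟩ := h (e.symm a)
      refine ⟨c, ?_⟩
      change e.symm (a - algebraMap k _ c) ∈ q
      rwa [map_sub, AlgEquiv.commutes]
    have : q'.IsPrime := Ideal.IsPrime.comap _
    have : q'.IsMaximal := isMaximal_of_forall_sub_mem q' Ideal.IsPrime.ne_top' hq'
    have : q'.LiesOver (q'.under (MvPolynomial (Fin s) k)) := ⟨rfl⟩
    have := Polynomial.height_eq_height_add_one (q'.under (MvPolynomial (Fin s) k)) q'
    rw [RingEquiv.height_comap] at this
    rw [this]
    have h3 := ih (q'.under (MvPolynomial (Fin s) k)) fun a => by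
      obtain ⟨c, hc⟩ := hq' (algebraMap _ _ a)
      refine ⟨c, ?_⟩
      change algebraMap _ _ (a - algebraMap k _ c) ∈ q'
      rwa [map_sub, ← IsScalarTower.algebraMap_apply]
    push_cast
    gcongr

/-- The transcendence degree of a local domain, essentially of finite type over `k` and with residue
field `k`, is at most its dimension. -/
lemma card_le_of_algebraicIndependent {k A K : Type*} [Field k] [CommRing A] [IsDomain A]
    [IsLocalRing A] [Algebra k A] [Algebra.EssFiniteType k A] [Field K] [Algebra A K]
    [IsFractionRing A K] [Algebra k K] [IsScalarTower k A K]
    (hclosed : ∀ a : A, ∃ c : k, a - algebraMap k A c ∈ maximalIdeal A)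
    {d : ℕ} (hdim : ringKrullDim A = d) {n : ℕ} {z : Fin n → K} (hz : AlgebraicIndependent k z) :
    n ≤ d := by
  let B := Algebra.EssFiniteType.subalgebra k A
  -- Noether normalization of a finitely generated algebra of which `A` is a localization. Going
  -- down yields `s ≤ d`, and the `s` coordinates generate a ring over which `K` is algebraic.
  obtain ⟨s, g, hg, hint⟩ := exists_integral_inj_algHom_of_fg k B
  have hsd : s ≤ d := by
    have hp : ((maximalIdeal A).under B).height = d := by
      rw [IsLocalization.height_under (Algebra.EssFiniteType.submonoid k A)]
      have := IsLocalRing.maximalIdeal_height_eq_ringKrullDim (R := A)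
      rw [hdim] at this
      exact_mod_cast this
    algebraize [g.toRingHom]
    have : FaithfulSMul (MvPolynomial (Fin s) k) B :=
      (faithfulSMul_iff_algebraMap_injective _ _).2 hg
    have : IsNoetherianRing B := Algebra.FiniteType.isNoetherianRing k B
    have h1 := Ideal.height_eq_height_add_of_liesOver_of_hasGoingDown
      (((maximalIdeal A).under B).under (MvPolynomial (Fin s) k)) ((maximalIdeal A).under B)
    have h2 := natCast_le_height_of_forall_sub_mem
      (((maximalIdeal A).under B).under (MvPolynomial (Fin s) k)) fun a => by
        obtain ⟨c, hc⟩ := hclosed (g a : B)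
        refine ⟨c, ?_⟩
        change ((g (a - algebraMap k _ c) : B) : A) ∈ maximalIdeal A
        rw [map_sub, AlgHom.commutes]
        exact hc
    rw [hp] at h1
    have h3 : (s : ℕ∞) ≤ d := h2.trans (h1 ▸ le_self_add)
    exact_mod_cast h3
  refine le_trans ?_ hsd
  let y : Fin s → K := fun i => algebraMap A K (g (MvPolynomial.X i) : B)
  have hB : ∀ b : B, IsAlgebraic (Algebra.adjoin k (Set.range y)) (algebraMap A K b) := by
    intro b
    let j : B →ₐ[k] K := (IsScalarTower.toAlgHom k A K).comp B.val
    have h1 : j.comp g = MvPolynomial.aeval y := by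
      ext i; simp [y, j]
    let φ : MvPolynomial (Fin s) k →ₐ[k] Algebra.adjoin k (Set.range y) :=
      (MvPolynomial.aeval y).codRestrict _ fun f => by
        rw [Algebra.adjoin_range_eq_range_aeval]; exact ⟨f, rfl⟩
    obtain ⟨P, hP, hP0⟩ := hint b
    refine IsIntegral.isAlgebraic ⟨P.map φ.toRingHom, hP.map _, ?_⟩
    have h2 : (algebraMap (Algebra.adjoin k (Set.range y)) K).comp φ.toRingHom =
        (j.toRingHom).comp g.toRingHom := by
      ext f
      · simp
      · simp [φ, y, j]
    rw [Polynomial.eval₂_map, h2]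
    have h3 := Polynomial.hom_eval₂ P g.toRingHom j.toRingHom b
    have h4 : Polynomial.eval₂ g.toRingHom b P = 0 := hP0
    rw [h4, map_zero] at h3
    exact h3.symm
  have : Algebra.IsAlgebraic (Algebra.adjoin k (Set.range y)) K := by
    refine ⟨fun z => ?_⟩
    have hA : ∀ a : A, IsAlgebraic (Algebra.adjoin k (Set.range y)) (algebraMap A K a) := by
      intro a
      obtain ⟨⟨b, m⟩, h⟩ := IsLocalization.surj (Algebra.EssFiniteType.submonoid k A) a
      have hm : algebraMap A K (algebraMap B A m) ≠ 0 := by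
        have := IsLocalization.map_units A m
        exact ((this.map (algebraMap A K))).ne_zero
      have : algebraMap A K a = algebraMap A K b * (algebraMap A K (m : B))⁻¹ := by
        refine (eq_mul_inv_iff_mul_eq₀ hm).2 ?_
        rw [← map_mul]
        exact congrArg _ h
      rw [this]
      exact (hB b).mul (hB m).inv
    obtain ⟨a, b, _, rfl⟩ := IsFractionRing.div_surjective (A := A) z
    rw [div_eq_mul_inv]
    exact (hA a).mul (hA b).inv
  have h1 := hz.lift_cardinalMk_le_trdeg
  have h2 := Algebra.IsAlgebraic.trdeg_le_cardinalMk k (Set.range y)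
  have h3 := Cardinal.mk_range_le_lift (f := y)
  simp only [Cardinal.mk_fin, Cardinal.lift_natCast, Cardinal.lift_uzero] at h1 h3
  exact_mod_cast h1.trans (h2.trans h3)

/-- If `t` were algebraic over the lifts of `z`, it would divide a nonzero polynomial in them. Its
image in `T` is then zero, contradicting the independence of `z`. -/
lemma exists_algebraicIndependent_succ {k S T : Type*} [Field k] [CommRing S] [IsDomain S]
    [CommRing T] [Algebra k S] [Algebra k T] (f : S →ₐ[k] T) (hf : Function.Surjective f) {t : S}
    (ht : f t = 0) (ht0 : t ≠ 0) {n : ℕ} {z : Fin n → T} (hz : AlgebraicIndependent k z) :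
    ∃ z : Fin (n + 1) → S, AlgebraicIndependent k z := by
  choose z' hz' using fun i => hf (z i)
  have hz'' : f ∘ z' = z := funext hz'
  rw [← hz''] at hz
  have h2 : AlgebraicIndependent k fun o : Option (Fin n) => o.elim t z' := by
    refine AlgebraicIndependent.option_iff.2 ⟨hz.of_comp, fun hal => ?_⟩
    obtain ⟨r, hr0, hr⟩ := hal.exists_nonzero_dvd (mem_nonZeroDivisors_of_ne_zero ht0)
    have hrp : (r : S) ∈ RingHom.ker f := Ideal.mem_of_dvd _ hr ht
    obtain ⟨r, hr'⟩ := r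
    rw [Algebra.adjoin_range_eq_range_aeval] at hr'
    obtain ⟨g, rfl⟩ := hr'
    refine hr0 (Subtype.ext ?_)
    have : MvPolynomial.aeval (f ∘ z') g = 0 := by
      have h3 : f (MvPolynomial.aeval z' g) = 0 := hrp
      rw [← h3]
      exact (MvPolynomial.comp_aeval_apply _ _ _).symm
    change MvPolynomial.aeval z' g = 0
    rw [algebraicIndependent_iff.1 hz g this, map_zero]
  exact ⟨_, h2.comp (finSuccEquiv n) (finSuccEquiv n).injective⟩

end Dimension

/-! ### Prime divisors of a normal germ. -/

section PrimeDivisors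

/-- This finds an associated prime of `z` modulo `S` inside `p`: among the conductors of the
multiples `a z` that are contained in `p`, a maximal one is prime. -/
lemma exists_isPrime_forall_mem_iff {S K : Type*} [CommRing S] [IsNoetherianRing S] [Field K]
    [Algebra S K] (z : K) (p : Ideal S) [p.IsPrime]
    (h : ∀ s r : S, algebraMap S K s * z = algebraMap S K r → s ∈ p) :
    ∃ a : S, ∃ q : Ideal S, q.IsPrime ∧ q ≤ p ∧
      ∀ s, s ∈ q ↔ ∃ r, algebraMap S K s * (algebraMap S K a * z) = algebraMap S K r := by
  let colon : K → Ideal S := fun y =>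
    (LinearMap.range (Algebra.linearMap S K)).comap (LinearMap.toSpanSingleton S K y)
  have mem_colon : ∀ y s, s ∈ colon y ↔ ∃ r, algebraMap S K s * y = algebraMap S K r := by
    intro y s
    simp only [colon, Submodule.mem_comap, LinearMap.toSpanSingleton_apply, LinearMap.mem_range,
      Algebra.linearMap_apply, Algebra.smul_def]
    exact ⟨fun ⟨r, hr⟩ => ⟨r, hr.symm⟩, fun ⟨r, hr⟩ => ⟨r, hr.symm⟩⟩
  have mem_mul : ∀ y s b, s ∈ colon (algebraMap S K b * y) ↔ s * b ∈ colon y := by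
    intro y s b
    rw [mem_colon, mem_colon, map_mul]
    simp only [mul_assoc]
  obtain ⟨q, ⟨⟨a, rfl⟩, hqp⟩, hmax⟩ := set_has_maximal_iff_noetherian.2 (inferInstance :
    IsNoetherian S S) {q : Ideal S | (∃ a : S, colon (algebraMap S K a * z) = q) ∧ q ≤ p}
    ⟨colon z, ⟨1, by rw [map_one, one_mul]⟩, fun s hs => by
      obtain ⟨r, hr⟩ := (mem_colon z s).1 hs
      exact h s r hr⟩
  refine ⟨a, _, ⟨fun htop => ?_, fun {u v} huv => ?_⟩, hqp, mem_colon _⟩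
  · exact Ideal.IsPrime.ne_top' (top_le_iff.1 (htop ▸ hqp))
  have hle : ∀ b, colon (algebraMap S K a * z) ≤ colon (algebraMap S K (a * b) * z) := by
    intro b s hs
    rw [mem_mul] at hs ⊢
    rw [← mul_assoc]
    exact Ideal.mul_mem_right _ _ hs
  have hstep : ∀ b s, s ∈ colon (algebraMap S K (a * b) * z) →
      colon (algebraMap S K (a * b) * z) ≤ p → s ∈ colon (algebraMap S K a * z) := by
    intro b s hs hle'
    have := hmax _ ⟨⟨_, rfl⟩, hle'⟩
    rw [lt_iff_le_not_ge, not_and, not_not] at this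
    exact this (hle b) hs
  rw [mem_mul] at huv
  by_cases hp : colon (algebraMap S K (a * v) * z) ≤ p
  · refine Or.inl (hstep v u ?_ hp)
    rw [mem_mul]
    convert huv using 1; ring
  -- As `s ∉ p`, the conductor of `a s z` is still contained in `p`, so maximality applies to it.
  · obtain ⟨s, hs, hsp⟩ := Set.not_subset.1 hp
    refine Or.inr (hstep s v ?_ ?_)
    · rw [SetLike.mem_coe, mem_mul] at hs
      rw [mem_mul]
      convert hs using 1; ring
    · intro t ht
      rw [mem_mul] at ht
      have : t * s ∈ p := hqp (by rw [mem_mul]; convert ht using 1; ring)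
      exact (Ideal.IsPrime.mem_or_mem ‹_› this).resolve_right hsp

variable {A K : Type*} [CommRing A] [Field K] [Algebra A K] [IsFractionRing A K]

lemma DivisorOver.inv_algebraMap_mem (E : DivisorOver A K) {b : A} (hb : b ∉ E.center) :
    (algebraMap A K b)⁻¹ ∈ E.ring := by
  have hb0 : b ≠ 0 := by rintro rfl; exact hb (zero_mem _)
  rw [E.mem_center_iff hb0, not_not] at hb
  exact hb

variable [IsDomain A]

variable (K) in
/-- The local ring of `Spec A` at the prime ideal `p`, as a subring of `K`. -/
def localSubalgebra (p : Ideal A) [p.IsPrime] : Subalgebra A K :=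
  Localization.subalgebra.ofField K p.primeCompl p.primeCompl_le_nonZeroDivisors

instance (p : Ideal A) [p.IsPrime] : IsLocalization.AtPrime (localSubalgebra K p) p :=
  Localization.subalgebra.isLocalization_ofField K p.primeCompl p.primeCompl_le_nonZeroDivisors

lemma mem_localSubalgebra {p : Ideal A} [p.IsPrime] {z : K} :
    z ∈ localSubalgebra K p ↔ ∃ a b : A, b ∉ p ∧ z = algebraMap A K a / algebraMap A K b := by
  simp only [div_eq_mul_inv]
  exact ⟨fun ⟨a, b, hb, h⟩ => ⟨a, b, hb, h⟩, fun ⟨a, b, hb, h⟩ => ⟨a, b, hb, h⟩⟩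

/-- Algebraic Hartogs: an associated prime `q` of `z` modulo a normal `A` has height one, because
its localization is a discrete valuation ring. -/
lemma exists_primeDivisor [IsNoetherianRing A] [IsIntegrallyClosed A] (p : Ideal A) [p.IsPrime]
    {z : K} (hz : z ∉ localSubalgebra K p) :
    ∃ P : PrimeDivisor A K, P.1.center ≤ p ∧ z ∉ P.1.ring ∧
      P.1.ring = localSubalgebra K P.1.center := by
  have hz0 : z ≠ 0 := by rintro rfl; exact hz (zero_mem _)
  obtain ⟨a, q, hq, hqp, hmem⟩ := exists_isPrime_forall_mem_iff z p fun s r h => by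
    by_contra hs
    refine hz (mem_localSubalgebra.2 ⟨r, s, hs, ?_⟩)
    rw [← h, mul_div_cancel_left₀]
    intro h0
    rw [(FaithfulSMul.algebraMap_eq_zero_iff A K).1 h0] at hs
    exact hs (zero_mem _)
  set y := algebraMap A K a * z with hy
  have hyA : ∀ r, algebraMap A K r ≠ y := fun r hr =>
    hq.one_notMem ((hmem 1).2 ⟨r, by rw [map_one, one_mul, hr]⟩)
  have hq0 : q ≠ ⊥ := by
    obtain ⟨u, v, hv, huv⟩ := IsFractionRing.div_surjective (A := A) y
    refine Submodule.ne_bot_iff _ |>.2 ⟨v, (hmem v).2 ⟨u, ?_⟩, nonZeroDivisors.ne_zero hv⟩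
    rw [← huv, mul_div_cancel₀]
    exact IsFractionRing.to_map_ne_zero_of_mem_nonZeroDivisors hv
  -- Otherwise `y q ⊆ q`, so `y` is integral over `A` and lies in `A`, which makes the conductor `q`
  -- the unit ideal.
  obtain ⟨a0, ha0, r, har, hr⟩ : ∃ a0 ∈ q, ∃ r, algebraMap A K a0 * y = algebraMap A K r ∧
      r ∉ q := by
    by_contra! hcon
    have : IsIntegral A y := by
      refine isIntegral_of_smul_mem_submodule (Submodule.map (Algebra.linearMap A K) q) ?_ ?_ y ?_
      · intro h
        refine hq0 (Submodule.map_injective_of_injective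
          (f := Algebra.linearMap A K) (FaithfulSMul.algebraMap_injective A K) ?_)
        rw [h, Submodule.map_bot]
      · exact (IsNoetherian.noetherian q).map _
      · rintro _ ⟨b, hb, rfl⟩
        obtain ⟨r, hr⟩ := (hmem b).1 hb
        refine ⟨r, hcon b hb r hr, ?_⟩
        rw [Algebra.linearMap_apply, ← hr, Algebra.linearMap_apply, smul_eq_mul, mul_comm]
    obtain ⟨r, hr⟩ := IsIntegrallyClosed.isIntegral_iff.1 this
    exact hyA r hr
  let T := localSubalgebra K q
  have hloc : IsLocalRing T := IsLocalization.AtPrime.isLocalRing T q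
  have hnoeth : IsNoetherianRing T := IsLocalization.isNoetherianRing q.primeCompl T inferInstance
  have hr0 : algebraMap A K r ≠ 0 := fun h => hr (by
    rw [(FaithfulSMul.algebraMap_eq_zero_iff A K).1 h]; exact zero_mem _)
  have hmax : maximalIdeal T = Ideal.span {algebraMap A T a0} := by
    refine le_antisymm (fun t ht => ?_) ?_
    · obtain ⟨b, s, hs, hbs⟩ := mem_localSubalgebra.1 t.2
      have hs0 : algebraMap A K s ≠ 0 := fun h => hs (by
        rw [(FaithfulSMul.algebraMap_eq_zero_iff A K).1 h]; exact zero_mem _)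
      have hb : b ∈ q := by
        rw [← IsLocalization.AtPrime.to_map_mem_maximal_iff T q b]
        have : algebraMap A T b = algebraMap A T s * t := Subtype.ext (by
          change algebraMap A K b = algebraMap A K s * t
          rw [hbs, mul_div_cancel₀ _ hs0])
        rw [this]
        exact Ideal.mul_mem_left _ _ ht
      obtain ⟨r', hr'⟩ := (hmem b).1 hb
      rw [Ideal.mem_span_singleton']
      -- From `a0 y = r` and `b y = r'` follows `b / s = (r' / (r s)) a0`, with `r s` outside `q`.
      refine ⟨⟨algebraMap A K r' / algebraMap A K (r * s), mem_localSubalgebra.2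
        ⟨r', r * s, fun h => (hq.mem_or_mem h).elim hr hs, rfl⟩⟩, Subtype.ext ?_⟩
      change algebraMap A K r' / algebraMap A K (r * s) * algebraMap A K a0 = t
      rw [hbs, ← hr', map_mul, ← har]
      have ha00 : algebraMap A K a0 ≠ 0 := fun h => hr0 (by rw [← har, h, zero_mul])
      have hy0 : y ≠ 0 := fun h => hr0 (by rw [← har, h, mul_zero])
      field_simp
    · rw [Ideal.span_singleton_le_iff_mem, IsLocalization.AtPrime.to_map_mem_maximal_iff T q]
      exact ha0
  have hpr : (maximalIdeal T).IsPrincipal := ⟨⟨_, hmax⟩⟩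
  have hpid : IsPrincipalIdealRing T :=
    ((tfae_of_isNoetherianRing_of_isLocalRing_of_isDomain T).out 0 4 :
      IsPrincipalIdealRing T ↔ (maximalIdeal T).IsPrincipal).2 hpr
  have hdvr : IsDiscreteValuationRing T := ⟨fun h => hq0 (by
    rw [← IsLocalization.AtPrime.under_maximalIdeal T q, h, Ideal.under,
      Ideal.comap_bot_of_injective]
    exact FaithfulSMul.algebraMap_injective A T)⟩
  have hcenter : (maximalIdeal T).comap (algebraMap A T) = q :=
    IsLocalization.AtPrime.under_maximalIdeal T q
  refine ⟨⟨⟨T, hdvr, Algebra.EssFiniteType.of_isLocalization T q.primeCompl⟩, ?_⟩, ?_, ?_, ?_⟩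
  · have h1 := IsLocalization.AtPrime.ringKrullDim_eq_height q T
    rw [IsDiscreteValuationRing.ringKrullDim_eq_one] at h1
    change Ideal.height ((maximalIdeal T).comap (algebraMap A T)) = 1
    rw [hcenter]
    exact_mod_cast h1.symm
  · exact hcenter.le.trans hqp
  · intro hzT
    obtain ⟨b, s, hs, hbs⟩ := mem_localSubalgebra.1 hzT
    have hs0 : algebraMap A K s ≠ 0 := fun h => hs (by
      rw [(FaithfulSMul.algebraMap_eq_zero_iff A K).1 h]; exact zero_mem _)
    refine hs ((hmem s).2 ⟨a * b, ?_⟩)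
    rw [hy, hbs, map_mul]
    field_simp
  · change T = localSubalgebra K ((maximalIdeal T).comap (algebraMap A T))
    simp only [hcenter, T]

lemma mem_range_of_forall_ord_nonneg [IsLocalRing A] [IsNoetherianRing A] [IsIntegrallyClosed A]
    {z : K} (hz : z ≠ 0) (h : ∀ P : PrimeDivisor A K, 0 ≤ P.1.ord z) : ∃ a, algebraMap A K a = z := by
  have hz' : z ∈ localSubalgebra K (maximalIdeal A) := by
    by_contra hcon
    obtain ⟨P, -, hP, -⟩ := exists_primeDivisor _ hcon
    exact hP ((P.1.ord_nonneg_iff hz).1 (h P))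
  obtain ⟨a, b, hb, rfl⟩ := mem_localSubalgebra.1 hz'
  rw [mem_maximalIdeal, mem_nonunits_iff, not_not] at hb
  obtain ⟨b, rfl⟩ := hb
  refine ⟨a * ↑b⁻¹, ?_⟩
  rw [map_mul, div_eq_mul_inv, map_units_inv]

lemma PrimeDivisor.ring_eq [IsNoetherianRing A] [IsIntegrallyClosed A] (P : PrimeDivisor A K) :
    P.1.ring = localSubalgebra K P.1.center := by
  refine le_antisymm (fun z hz => ?_) (fun z hz => ?_)
  · by_contra hcon
    obtain ⟨P', hP', hzP', hring⟩ := exists_primeDivisor _ hcon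
    -- Both centres have height one, so the inclusion cannot be strict. It remains to compare two
    -- discrete valuation rings with the same centre.
    have hc : P'.1.center = P.1.center := by
      by_contra hne
      have : P.1.center.FiniteHeight :=
        (Ideal.finiteHeight_iff _).2 (Or.inr (by rw [P.2]; exact ENat.one_ne_top))
      have := Ideal.height_strict_mono_of_isPrime_of_isPrime (lt_of_le_of_ne hP' hne)
      rw [P.2, P'.2] at this
      exact lt_irrefl _ this
    have hz0 : z ≠ 0 := by rintro rfl; exact hzP' (zero_mem _)
    have hz' := (P'.1.mem_or_inv_mem z).resolve_left hzP'
    rw [hring] at hz'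
    obtain ⟨a, b, hb, hab⟩ := mem_localSubalgebra.1 hz'
    have hb0 : b ≠ 0 := by rintro rfl; exact hb (zero_mem _)
    have hb0' : algebraMap A K b ≠ 0 := by simpa using hb0
    have ha0' : algebraMap A K a ≠ 0 := by
      intro h; rw [h, zero_div] at hab; exact inv_ne_zero hz0 hab
    have hzab : z = algebraMap A K b / algebraMap A K a := by
      rw [← inv_inv z, hab, inv_div]
    have ha : a ∈ P.1.center := by
      rw [← hc]
      by_contra ha
      refine hzP' ?_
      rw [hzab, div_eq_mul_inv]
      exact mul_mem (P'.1.ring.algebraMap_mem b) (P'.1.inv_algebraMap_mem ha)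
    rw [hc] at hb
    refine hb ?_
    have : algebraMap A P.1.ring b = ⟨z, hz⟩ * algebraMap A P.1.ring a := Subtype.ext (by
      change algebraMap A K b = z * algebraMap A K a
      rw [hzab, div_mul_cancel₀ _ ha0'])
    change algebraMap A P.1.ring b ∈ maximalIdeal P.1.ring
    rw [this]
    exact Ideal.mul_mem_left _ _ ha
  · obtain ⟨a, b, hb, rfl⟩ := mem_localSubalgebra.1 hz
    rw [div_eq_mul_inv]
    exact mul_mem (P.1.ring.algebraMap_mem a) (P.1.inv_algebraMap_mem hb)

end PrimeDivisors

/-! ### Charts and local rings of the blow up. -/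

section BlowupCharts

variable {A K : Type*} [CommRing A] [IsLocalRing A] [Field K] [Algebra A K]

lemma div_mem_blowupChart {x a : A} (ha : a ∈ maximalIdeal A) :
    algebraMap A K a / algebraMap A K x ∈ blowupChart A K x :=
  Algebra.subset_adjoin ⟨a, ha, rfl⟩

lemma IsBlowupLocalRing.exists_chart {R : Subalgebra A K} (h : IsBlowupLocalRing R) :
    ∃ x ∈ maximalIdeal A, algebraMap A K x ≠ 0 ∧ blowupChart A K x ≤ R ∧
      ∀ z ∈ R, ∃ a ∈ blowupChart A K x, ∃ b ∈ blowupChart A K x, b ≠ 0 ∧ b⁻¹ ∈ R ∧ z = a / b := by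
  obtain ⟨x, hx, hx0, p, hp, h⟩ := h
  refine ⟨x, hx, hx0, fun c hc => (h c).2 ⟨⟨c, hc⟩, 1, hp.one_notMem, by simp⟩, fun z hz => ?_⟩
  obtain ⟨a, b, hb, rfl⟩ := (h z).1 hz
  refine ⟨a, a.2, b, b.2, fun h0 => hb ?_, (h _).2 ⟨1, b, hb, by simp⟩, rfl⟩
  rw [show b = 0 from Subtype.ext h0]
  exact zero_mem _

lemma DivisorOver.isBlowupLocalRing (E : DivisorOver A K) {x : A} (hx : x ∈ maximalIdeal A)
    (hx0 : algebraMap A K x ≠ 0) (hle : blowupChart A K x ≤ E.ring)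
    (hE : ∀ z ∈ E.ring, ∃ a ∈ blowupChart A K x, ∃ b ∈ blowupChart A K x, b ≠ 0 ∧ b⁻¹ ∈ E.ring ∧
      z = a / b) : IsBlowupLocalRing E.ring := by
  have hp : ∀ b : blowupChart A K x,
      b ∉ (maximalIdeal E.ring).comap (Subalgebra.inclusion hle) ↔ (b : K)⁻¹ ∈ E.ring ∧ b ≠ 0 := by
    intro b
    rw [Ideal.mem_comap, E.mem_maximalIdeal_iff, not_or, not_not]
    refine and_congr Iff.rfl (not_congr ⟨fun h => Subtype.ext ?_, fun h => Subtype.ext ?_⟩)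
    · exact congrArg (Subtype.val : E.ring → K) h
    · exact congrArg (Subtype.val : blowupChart A K x → K) h
  refine ⟨x, hx, hx0, (maximalIdeal E.ring).comap (Subalgebra.inclusion hle), inferInstance,
    fun z => ⟨fun hz => ?_, ?_⟩⟩
  · obtain ⟨a, ha, b, hb, hb0, hb', rfl⟩ := hE z hz
    exact ⟨⟨a, ha⟩, ⟨b, hb⟩, (hp _).2 ⟨hb', fun h => hb0 (congrArg Subtype.val h)⟩, rfl⟩
  · rintro ⟨a, b, hb, rfl⟩
    rw [div_eq_mul_inv]
    exact mul_mem (hle a.2) ((hp b).1 hb).1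

lemma blowupChart_finiteType [IsNoetherianRing A] (x : A) :
    Algebra.FiniteType A (blowupChart A K x) := by
  obtain ⟨s, hs⟩ := IsNoetherian.noetherian (maximalIdeal A)
  classical
  have : blowupChart A K x =
      Algebra.adjoin A (s.image fun a => algebraMap A K a / algebraMap A K x : Finset K) := by
    refine le_antisymm (Algebra.adjoin_le ?_) (Algebra.adjoin_mono ?_)
    · rintro _ ⟨a, ha, rfl⟩
      rw [← hs] at ha
      induction ha using Submodule.span_induction with
      | mem a ha =>
        refine Algebra.subset_adjoin ?_
        rw [Finset.coe_image]
        exact ⟨a, ha, rfl⟩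
      | zero => rw [map_zero, zero_div]; exact zero_mem _
      | add a b _ _ ha hb => rw [map_add, add_div]; exact add_mem ha hb
      | smul c a _ ha =>
        rw [smul_eq_mul, map_mul, mul_div_assoc]
        exact mul_mem (Subalgebra.algebraMap_mem _ _) ha
    · rw [Finset.coe_image]
      rintro _ ⟨a, ha, rfl⟩
      exact ⟨a, hs ▸ Submodule.subset_span ha, rfl⟩
  rw [← Subalgebra.fg_iff_finiteType, this]
  exact ⟨_, rfl⟩

lemma IsBlowupLocalRing.essFiniteType [IsNoetherianRing A] {R : Subalgebra A K}
    (h : IsBlowupLocalRing R) : Algebra.EssFiniteType A R := by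
  obtain ⟨x, hx, hx0, p, hp, h⟩ := h
  have hle : blowupChart A K x ≤ R := fun c hc =>
    (h c).2 ⟨⟨c, hc⟩, 1, hp.one_notMem, by simp⟩
  let i : blowupChart A K x →ₐ[A] R := Subalgebra.inclusion hle
  let : Algebra (blowupChart A K x) R := i.toRingHom.toAlgebra
  have : IsScalarTower A (blowupChart A K x) R := IsScalarTower.of_algebraMap_eq fun a => rfl
  have hne : ∀ b : blowupChart A K x, b ∉ p → (b : K) ≠ 0 := fun b hb h0 => hb (by
    rw [show b = 0 from Subtype.ext h0]; exact zero_mem _)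
  have : IsLocalization.AtPrime R p :=
    { map_units := fun b => IsUnit.of_mul_eq_one
        (⟨(b : K)⁻¹, (h _).2 ⟨1, b, b.2, by simp⟩⟩ : R)
        (Subtype.ext (mul_inv_cancel₀ (hne b b.2)))
      surj := fun z => by
        obtain ⟨a, b, hb, hz⟩ := (h z).1 z.2
        refine ⟨⟨a, ⟨b, hb⟩⟩, Subtype.ext ?_⟩
        change (z : K) * b = a
        rw [hz, div_mul_cancel₀ _ (hne b hb)]
      exists_of_eq := fun {a b} hab => ⟨1, by
        have : (a : K) = b := congrArg (Subtype.val : R → K) hab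
        rw [Subtype.ext this]⟩ }
  have h1 : Algebra.FiniteType A (blowupChart A K x) := blowupChart_finiteType x
  have h2 : Algebra.EssFiniteType (blowupChart A K x) R :=
    Algebra.EssFiniteType.of_isLocalization R p.primeCompl
  exact Algebra.EssFiniteType.comp A (blowupChart A K x) R

/-- Every `a ∈ 𝔪` equals `(a / x) x`, so the fibre is a Cartier divisor with equation `x` on this
chart. -/
lemma BlowupPoint.fibreIdeal_eq_span (w : BlowupPoint A K) {x : A} (hx : x ∈ maximalIdeal A)
    (hx0 : algebraMap A K x ≠ 0) (hle : blowupChart A K x ≤ w.ring) :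
    w.fibreIdeal = Ideal.span {algebraMap A w.ring x} := by
  refine le_antisymm (Ideal.map_le_iff_le_comap.2 fun a ha => ?_) ?_
  · rw [Ideal.mem_comap, Ideal.mem_span_singleton']
    exact ⟨⟨_, hle (div_mem_blowupChart ha)⟩, Subtype.ext (div_mul_cancel₀ _ hx0)⟩
  · rw [Ideal.span_singleton_le_iff_mem]
    exact Ideal.mem_map_of_mem _ hx

/-- An element of the chart of `x'` is a polynomial in the fractions `a / x'`; a high power of `x' /
x` turns them into `a / x`. All large exponents are allowed so that numerator and denominator can
share one. -/
lemma exists_mul_pow_mem_blowupChart {x x' : A} (hx' : x' ∈ maximalIdeal A)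
    (hx'0 : algebraMap A K x' ≠ 0) {c : K} (hc : c ∈ blowupChart A K x') :
    ∃ N : ℕ, ∀ M ≥ N, c * (algebraMap A K x' / algebraMap A K x) ^ M ∈ blowupChart A K x := by
  have hτ : algebraMap A K x' / algebraMap A K x ∈ blowupChart A K x := div_mem_blowupChart hx'
  unfold blowupChart at hc
  induction hc using Algebra.adjoin_induction with
  | mem c hc =>
    obtain ⟨a, ha, rfl⟩ := hc
    refine ⟨1, fun M hM => ?_⟩
    obtain ⟨M, rfl⟩ := Nat.exists_eq_add_of_le' hM
    have : algebraMap A K a / algebraMap A K x' * (algebraMap A K x' / algebraMap A K x) ^ (M + 1) =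
        algebraMap A K a / algebraMap A K x * (algebraMap A K x' / algebraMap A K x) ^ M := by
      rw [pow_succ]; field_simp
    rw [this]
    exact mul_mem (div_mem_blowupChart ha) (pow_mem hτ _)
  | algebraMap r => exact ⟨0, fun M _ => mul_mem (Subalgebra.algebraMap_mem _ _) (pow_mem hτ _)⟩
  | add a b _ _ ha hb =>
    obtain ⟨N, hN⟩ := ha; obtain ⟨N', hN'⟩ := hb
    refine ⟨max N N', fun M hM => ?_⟩
    rw [add_mul]
    exact add_mem (hN M (le_of_max_le_left hM)) (hN' M (le_of_max_le_right hM))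
  | mul a b _ _ ha hb =>
    obtain ⟨N, hN⟩ := ha; obtain ⟨N', hN'⟩ := hb
    refine ⟨N + N', fun M hM => ?_⟩
    obtain ⟨M, rfl⟩ := Nat.exists_eq_add_of_le hM
    rw [show N + N' + M = N + (N' + M) by ring, pow_add, mul_mul_mul_comm]
    exact mul_mem (hN _ le_rfl) (hN' _ (by omega))

/-- Any two points of the blow up have a common affine neighbourhood in the chart of the first. -/
lemma IsBlowupLocalRing.exists_eq_div {R R' : Subalgebra A K} (h : IsBlowupLocalRing R)
    (h' : IsBlowupLocalRing R') {z : K} (hz : z ∈ R') :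
    ∃ a ∈ R, ∃ b ∈ R, b ≠ 0 ∧ b⁻¹ ∈ R' ∧ z = a / b := by
  obtain ⟨x, hx, hx0, hc, -⟩ := h.exists_chart
  obtain ⟨x', hx', hx'0, hc', H⟩ := h'.exists_chart
  obtain ⟨a, ha, b, hb, hb0, hb', rfl⟩ := H z hz
  obtain ⟨N, hN⟩ := exists_mul_pow_mem_blowupChart (x := x) hx' hx'0 ha
  obtain ⟨N', hN'⟩ := exists_mul_pow_mem_blowupChart (x := x) hx' hx'0 hb
  have hτ := pow_ne_zero (max N N') (div_ne_zero hx'0 hx0)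
  refine ⟨_, hc (hN _ (le_max_left N N')), _, hc (hN' _ (le_max_right N N')),
    mul_ne_zero hb0 hτ, ?_, (mul_div_mul_right _ _ hτ).symm⟩
  rw [mul_inv, ← inv_pow, inv_div]
  exact mul_mem hb' (pow_mem (hc' (div_mem_blowupChart hx)) _)

variable [IsDomain A] [IsFractionRing A K] [IsNoetherianRing A] [IsIntegrallyClosed A]

/-- The blow up is an isomorphism away from `o`: some `x ∈ 𝔪` is a unit at `P`, and its chart has
`𝒪_P` as a localization. -/
lemma PrimeDivisor.isBlowupLocalRing (P : PrimeDivisor A K)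
    (hP : P.1.center ≠ maximalIdeal A) : IsBlowupLocalRing P.1.ring := by
  obtain ⟨x, hx, hxP⟩ := Set.exists_of_ssubset
    (SetLike.coe_ssubset_coe.2
      (lt_of_le_of_ne (IsLocalRing.le_maximalIdeal (Ideal.IsPrime.ne_top inferInstance)) hP))
  have hx0 : x ≠ 0 := by rintro rfl; exact hxP (zero_mem _)
  have hx' := P.1.inv_algebraMap_mem hxP
  refine P.1.isBlowupLocalRing hx (by simpa using hx0) (Algebra.adjoin_le ?_) fun z hz => ?_
  · rintro _ ⟨a, -, rfl⟩
    rw [div_eq_mul_inv]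
    exact mul_mem (P.1.ring.algebraMap_mem a) hx'
  · rw [P.ring_eq] at hz
    obtain ⟨a, b, hb, rfl⟩ := mem_localSubalgebra.1 hz
    refine ⟨_, Subalgebra.algebraMap_mem _ a, _, Subalgebra.algebraMap_mem _ b, ?_,
      P.1.inv_algebraMap_mem hb, rfl⟩
    have : b ≠ 0 := by rintro rfl; exact hb (zero_mem _)
    simpa using this

end BlowupCharts

/-! ### Local rings with two parameters. -/

section RegularParameters

variable {R : Type*} [CommRing R] [IsLocalRing R] {x y : R}

/-- The element `y` lifts a generator of the maximal ideal of the regular one-dimensional `R ⧸ (x)`.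
If it were nilpotent there, that quotient would have dimension zero. -/
lemma exists_maximalIdeal_eq_span_pair
    (hreg : IsRegularLocalRing (R ⧸ Ideal.span {x}))
    (hdim : ringKrullDim (R ⧸ Ideal.span {x}) = 1) :
    ∃ y, maximalIdeal R = Ideal.span {x, y} ∧ ∀ k : ℕ, y ^ k ∉ Ideal.span {x} := by
  have h1 := hreg.spanFinrank_maximalIdeal
  rw [hdim] at h1
  have h1 : (maximalIdeal (R ⧸ Ideal.span {x})).spanFinrank = 1 := by exact_mod_cast h1
  obtain ⟨y', hy'⟩ : ∃ y', maximalIdeal (R ⧸ Ideal.span {x}) = Ideal.span {y'} :=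
    ((Submodule.spanFinrank_eq_one_iff _).1 h1).1.principal
  obtain ⟨y, rfl⟩ := Ideal.Quotient.mk_surjective y'
  have hcomap : (maximalIdeal (R ⧸ Ideal.span {x})).comap (Ideal.Quotient.mk (Ideal.span {x})) =
      maximalIdeal R := by
    have := Ideal.comap_isMaximal_of_surjective (Ideal.Quotient.mk (Ideal.span {x}))
      Ideal.Quotient.mk_surjective (K := maximalIdeal (R ⧸ Ideal.span {x}))
    exact IsLocalRing.eq_maximalIdeal this
  refine ⟨y, ?_, fun k hk => ?_⟩
  · rw [← hcomap, hy', ← Set.image_singleton, ← Ideal.map_span,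
      Ideal.comap_map_of_surjective _ Ideal.Quotient.mk_surjective, ← RingHom.ker_eq_comap_bot,
      Ideal.mk_ker, ← Ideal.span_union, Set.union_comm]
    rfl
  · rw [← Ideal.Quotient.eq_zero_iff_mem, map_pow] at hk
    have h0 : Ring.KrullDimLE 0 (R ⧸ Ideal.span {x}) := by
      refine Ring.KrullDimLE.mk₀ fun I hI => ?_
      have : maximalIdeal (R ⧸ Ideal.span {x}) ≤ I := by
        rw [hy', Ideal.span_singleton_le_iff_mem]
        exact hI.mem_of_pow_mem k (hk ▸ zero_mem _)
      rw [← (maximalIdeal.isMaximal _).eq_of_le hI.ne_top this]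
      exact maximalIdeal.isMaximal _
    rw [ringKrullDimZero_iff_ringKrullDim_eq_zero.1 h0] at hdim
    exact zero_ne_one hdim

variable [IsNoetherianRing R]

/-- Modulo `x` the maximal ideal is generated by `y`, and Krull's intersection theorem gives the
largest power of `y` dividing `r`; the cofactor is a unit. For the equation of `D⁺` this `k` is the
intersection multiplicity. -/
lemma exists_eq_unit_mul_pow_add (hm : maximalIdeal R = Ideal.span {x, y}) {r : R}
    (hr : r ∉ Ideal.span {x}) : ∃ (k : ℕ) (u s : R), IsUnit u ∧ r = u * y ^ k + x * s := by
  have hx : x ∈ maximalIdeal R := hm ▸ Ideal.subset_span (by simp)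
  have hy : y ∈ maximalIdeal R := hm ▸ Ideal.subset_span (by simp)
  let S := R ⧸ Ideal.span {x}
  let π : R →+* S := Ideal.Quotient.mk _
  have : Nontrivial S := Ideal.Quotient.nontrivial_iff.2
    (ne_top_of_le_ne_top (maximalIdeal.isMaximal R).ne_top
      ((Ideal.span_singleton_le_iff_mem _).2 hx))
  have : IsLocalRing S := IsLocalRing.of_surjective' π Ideal.Quotient.mk_surjective
  have hI : Ideal.span {π y} ≠ ⊤ := by
    rw [Ne, Ideal.span_singleton_eq_top]
    intro hu
    have : IsLocalHom π := IsLocalHom.of_surjective π Ideal.Quotient.mk_surjective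
    exact (mem_maximalIdeal y).1 hy (isUnit_of_map_unit π y hu)
  have hex : ∃ k, π r ∉ Ideal.span {π y} ^ (k + 1) := by
    by_contra! hcon
    have : π r ∈ ⨅ i : ℕ, Ideal.span {π y} ^ i := by
      rw [Ideal.mem_iInf]
      rintro (_ | i)
      · simp
      · exact hcon i
    rw [Ideal.iInf_pow_eq_bot_of_isLocalRing (Ideal.span {π y}) hI] at this
    exact hr (Ideal.Quotient.eq_zero_iff_mem.1 this)
  classical
  obtain ⟨k, hk, hmin⟩ : ∃ k, π r ∉ Ideal.span {π y} ^ (k + 1) ∧ π r ∈ Ideal.span {π y} ^ k := by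
    refine ⟨Nat.find hex, Nat.find_spec hex, ?_⟩
    rcases h : Nat.find hex with _ | k
    · simp
    · by_contra hcon
      exact Nat.find_min hex (h ▸ Nat.lt_succ_self k) hcon
  rw [Ideal.span_singleton_pow, Ideal.mem_span_singleton'] at hmin
  obtain ⟨u', hu'⟩ := hmin
  obtain ⟨u, rfl⟩ := Ideal.Quotient.mk_surjective u'
  have h1 : r - u * y ^ k ∈ Ideal.span {x} := by
    rw [← Ideal.Quotient.eq_zero_iff_mem, map_sub, map_mul, map_pow, sub_eq_zero]
    exact hu'.symm
  obtain ⟨s, hs⟩ := Ideal.mem_span_singleton'.1 h1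
  refine ⟨k, u, s, ?_, by rw [mul_comm x s, hs]; ring⟩
  by_contra hu
  have hum : u ∈ maximalIdeal R := hu
  rw [hm, Ideal.mem_span_pair] at hum
  obtain ⟨a, b, hab⟩ := hum
  refine hk ?_
  rw [Ideal.span_singleton_pow, Ideal.mem_span_singleton']
  refine ⟨π b, ?_⟩
  have hx0 : π x = 0 := Ideal.Quotient.eq_zero_iff_mem.2 (Ideal.mem_span_singleton_self x)
  rw [← hu']
  change _ = π u * π y ^ k
  rw [← hab, map_add, map_mul, map_mul, hx0]
  ring

lemma isPrime_span_singleton (hm : maximalIdeal R = Ideal.span {x, y})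
    (hy : ∀ k : ℕ, y ^ k ∉ Ideal.span {x}) : (Ideal.span {x}).IsPrime := by
  refine ⟨fun h => hy 0 (h ▸ Submodule.mem_top), fun {a b} hab => ?_⟩
  by_contra! hcon
  obtain ⟨k, u, s, hu, rfl⟩ := exists_eq_unit_mul_pow_add hm hcon.1
  obtain ⟨l, v, t, hv, rfl⟩ := exists_eq_unit_mul_pow_add hm hcon.2
  refine hy (k + l) ((Ideal.unit_mul_mem_iff_mem _ (hu.mul hv)).1 ?_)
  have h1 : u * v * y ^ (k + l) = (u * y ^ k + x * s) * (v * y ^ l + x * t) -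
      (s * (v * y ^ l) + t * (u * y ^ k) + x * s * t) * x := by ring
  rw [h1]
  exact sub_mem hab (Ideal.mul_mem_left _ _ (Ideal.mem_span_singleton_self x))

lemma eq_span_or_eq_maximalIdeal (hm : maximalIdeal R = Ideal.span {x, y}) {q : Ideal R}
    [q.IsPrime] (hx : x ∈ q) : q = Ideal.span {x} ∨ q = maximalIdeal R := by
  by_cases h : q ≤ Ideal.span {x}
  · exact Or.inl (le_antisymm h ((Ideal.span_singleton_le_iff_mem _).2 hx))
  obtain ⟨r, hr, hrx⟩ := Set.not_subset.1 h
  obtain ⟨k, u, s, hu, rfl⟩ := exists_eq_unit_mul_pow_add hm hrx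
  have h1 : u * y ^ k ∈ q := (Ideal.add_mem_iff_left _ (Ideal.mul_mem_right _ _ hx)).1 hr
  have h2 : y ∈ q := Ideal.IsPrime.mem_of_pow_mem ‹_› k ((Ideal.unit_mul_mem_iff_mem _ hu).1 h1)
  refine Or.inr (le_antisymm (IsLocalRing.le_maximalIdeal (Ideal.IsPrime.ne_top ‹_›)) ?_)
  rw [hm, Ideal.span_le]
  rintro _ (rfl | rfl) <;> assumption

/-- The quotient is `S ⧸ (y ^ k)` for the discrete valuation ring `S = R ⧸ (x)`, and length over `R`
agrees with length over `S`. -/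
lemma length_quotient_sup (hm : maximalIdeal R = Ideal.span {x, y})
    (hy : ∀ k : ℕ, y ^ k ∉ Ideal.span {x}) {k : ℕ} {u s : R} (hu : IsUnit u) :
    Module.length R (R ⧸ (Ideal.span {u * y ^ k + x * s} ⊔ Ideal.span {x})) = k := by
  have hp := isPrime_span_singleton hm hy
  let S := R ⧸ Ideal.span {x}
  let π : R →+* S := Ideal.Quotient.mk _
  have hπ : Function.Surjective π := Ideal.Quotient.mk_surjective
  have : IsLocalRing S := IsLocalRing.of_surjective' π Ideal.Quotient.mk_surjective
  have hx0 : π x = 0 := Ideal.Quotient.eq_zero_iff_mem.2 (Ideal.mem_span_singleton_self x)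
  have hmax : maximalIdeal S = Ideal.span {π y} := by
    have h1 : (maximalIdeal S).comap π = maximalIdeal R :=
      IsLocalRing.eq_maximalIdeal
        (Ideal.comap_isMaximal_of_surjective π hπ (K := maximalIdeal S))
    rw [← Ideal.map_comap_of_surjective π hπ (maximalIdeal S), h1, hm, Ideal.map_span,
      Set.image_pair, hx0, Ideal.span_insert_zero]
  have hpr : (maximalIdeal S).IsPrincipal := ⟨⟨_, hmax⟩⟩
  have hpid : IsPrincipalIdealRing S :=
    ((tfae_of_isNoetherianRing_of_isLocalRing_of_isDomain S).out 0 4 :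
      IsPrincipalIdealRing S ↔ (maximalIdeal S).IsPrincipal).2 hpr
  have hy0 : π y ≠ 0 := fun h => hy 1 (by
    rw [pow_one]; exact Ideal.Quotient.eq_zero_iff_mem.1 h)
  have hirr : Irreducible (π y) :=
    ((Ideal.span_singleton_prime hy0).1 (hmax ▸ (maximalIdeal.isMaximal S).isPrime)).irreducible
  have hord : Ring.ord S (π (u * y ^ k + x * s)) = k := by
    rw [map_add, map_mul, map_mul, map_pow, hx0, zero_mul, add_zero,
      Ring.ord_mul_of_isUnit_left (hu.map π),
      Ring.ord_pow (mem_nonZeroDivisors_of_ne_zero hy0), Ring.ord_of_irreducible hirr]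
    simp
  rw [sup_comm, ← (DoubleQuot.quotQuotEquivQuotSupₐ R (Ideal.span {x})
    (Ideal.span {u * y ^ k + x * s})).toLinearEquiv.length_eq, ← hord, Ring.ord,
    Ideal.map_span, Set.image_singleton]
  have : IsScalarTower R S (S ⧸ Ideal.span {π (u * y ^ k + x * s)}) :=
    inferInstanceAs (IsScalarTower R (R ⧸ Ideal.span {x}) _)
  exact (Module.length_eq_of_surjective (R := S) (S := R)
    (M := S ⧸ Ideal.span {π (u * y ^ k + x * s)}) hπ)

end RegularParameters

/-! ### Derivations and multiplicities in characteristic zero. -/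

section Euler

variable {R : Type*} [CommRing R] [Algebra ℂ R] {x y : R}

lemma natCast_succ_mul_mem_iff (I : Ideal R) (j : ℕ) {f : R} :
    ((j + 1 : ℕ) : R) * f ∈ I ↔ f ∈ I := by
  refine Ideal.unit_mul_mem_iff_mem _ ?_
  have := (isUnit_iff_ne_zero.2 (Nat.cast_ne_zero.2 j.succ_ne_zero : ((j + 1 : ℕ) : ℂ) ≠ 0)).map
    (algebraMap ℂ R)
  rwa [map_natCast] at this

lemma mem_span_pow_succ_of_derivation (δ : Derivation ℂ R R) (hx : δ x = 0) (hy : δ y = 1)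
    {k : ℕ} {f : R} (hf : f ∈ Ideal.span {x, y}) (h : δ f ∈ Ideal.span {x, y ^ k}) :
    f ∈ Ideal.span {x, y ^ (k + 1)} := by
  suffices H : ∀ j ≤ k, f ∈ Ideal.span {x, y ^ (j + 1)} from H k le_rfl
  intro j
  induction j with
  | zero => intro _; simpa using hf
  | succ j ih =>
    intro hj
    obtain ⟨a, b, hab⟩ := Ideal.mem_span_pair.1 (ih (by omega))
    obtain ⟨c, e, hce⟩ := Ideal.mem_span_pair.1 h
    have h1 : δ f = x * δ a + (b * ((j + 1 : ℕ) * y ^ j) + y ^ (j + 1) * δ b) := by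
      rw [← hab, map_add, Derivation.leibniz, Derivation.leibniz, Derivation.leibniz_pow, hx, hy]
      simp
    -- With `f = a x + b y ^ (j + 1)`, both `y δ f` and `(j + 1) f` are congruent to `(j + 1) b y ^
    -- (j + 1)` modulo `(x, y ^ (j + 2))`, an ideal that contains `y δ f`.
    rw [← natCast_succ_mul_mem_iff _ j, Ideal.mem_span_pair]
    obtain ⟨l, rfl⟩ := Nat.exists_eq_add_of_le hj
    refine ⟨y * c - y * δ a + (j + 1 : ℕ) * a, e * y ^ l - δ b, ?_⟩
    have h2 : y * δ f = y * (c * x + e * y ^ (j + 1 + l)) := by rw [hce]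
    rw [h1] at h2
    rw [← hab]
    linear_combination -h2

/-- Euler's identity: a derivation acting as the identity on `I / I ^ 2` acts as multiplication by
`j` on `I ^ j / I ^ (j + 1)`. -/
lemma sub_mem_pow_succ_of_derivation {I : Ideal R} (δ : Derivation ℂ R R)
    (hδ : ∀ g ∈ I, δ g - g ∈ I ^ 2) (hδ' : ∀ g, δ g ∈ I) (j : ℕ) {g : R} (hg : g ∈ I ^ j) :
    δ g - j * g ∈ I ^ (j + 1) := by
  induction j generalizing g with
  | zero => simpa using hδ' g
  | succ j ih =>
    rw [pow_succ] at hg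
    refine Submodule.mul_induction_on hg (fun a ha b hb => ?_) (fun a b ha hb => ?_)
    · have h1 : δ (a * b) - ((j + 1 : ℕ) : R) * (a * b) = a * (δ b - b) + b * (δ a - j * a) := by
        rw [Derivation.leibniz]; push_cast; simp only [smul_eq_mul]; ring
      rw [h1]
      refine add_mem ?_ ?_
      · rw [show j + 1 + 1 = j + 2 from rfl, pow_add]
        exact Ideal.mul_mem_mul ha (hδ b hb)
      · rw [pow_succ']
        exact Ideal.mul_mem_mul hb (ih ha)
    · have h1 : δ (a + b) - ((j + 1 : ℕ) : R) * (a + b) =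
          (δ a - ((j + 1 : ℕ) : R) * a) + (δ b - ((j + 1 : ℕ) : R) * b) := by
        rw [map_add]; ring
      rw [h1]
      exact add_mem ha hb

/-- The Euler field `x δ₀ + y δ₁` sends `f` into `I ^ (k + 1)`. As it multiplies leading terms of
degree `j + 1` by the unit `j + 1`, the order of `f` rises step by step to `k + 1`. -/
lemma mem_pow_succ_of_derivation (δ₀ δ₁ : Derivation ℂ R R) (h₀x : δ₀ x = 1) (h₀y : δ₀ y = 0)
    (h₁x : δ₁ x = 0) (h₁y : δ₁ y = 1) {k : ℕ} {f : R} (hf : f ∈ Ideal.span {x, y})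
    (h₀ : δ₀ f ∈ Ideal.span {x, y} ^ k) (h₁ : δ₁ f ∈ Ideal.span {x, y} ^ k) :
    f ∈ Ideal.span {x, y} ^ (k + 1) := by
  set I := Ideal.span {x, y} with hI
  have hxI : x ∈ I := Ideal.subset_span (by simp)
  have hyI : y ∈ I := Ideal.subset_span (by simp)
  set δ : Derivation ℂ R R := x • δ₀ + y • δ₁ with hδdef
  have hδ' : ∀ g, δ g = x * δ₀ g + y * δ₁ g := fun g => rfl
  have hmem : ∀ g, δ g ∈ I := fun g => by
    rw [hδ']
    exact add_mem (Ideal.mul_mem_right _ _ hxI) (Ideal.mul_mem_right _ _ hyI)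
  have hδ : ∀ g ∈ I, δ g - g ∈ I ^ 2 := by
    intro g hg
    obtain ⟨a, b, rfl⟩ := Ideal.mem_span_pair.1 hg
    have hdx : δ x = x := by rw [hδ', h₀x, h₁x]; ring
    have hdy : δ y = y := by rw [hδ', h₀y, h₁y]; ring
    have : δ (a * x + b * y) - (a * x + b * y) = x * δ a + y * δ b := by
      rw [map_add, Derivation.leibniz, Derivation.leibniz, hdx, hdy]
      simp only [smul_eq_mul]; ring
    rw [this, pow_two]
    exact add_mem (Ideal.mul_mem_mul hxI (hmem a)) (Ideal.mul_mem_mul hyI (hmem b))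
  suffices H : ∀ j ≤ k, f ∈ I ^ (j + 1) from H k le_rfl
  intro j
  induction j with
  | zero => intro _; simpa using hf
  | succ j ih =>
    intro hj
    have h2 := sub_mem_pow_succ_of_derivation δ hδ hmem (j + 1) (ih (by omega))
    have h3 : δ f ∈ I ^ (j + 1 + 1) := by
      refine Ideal.pow_le_pow_right (show j + 1 + 1 ≤ k + 1 by omega) ?_
      rw [hδ', pow_succ']
      exact add_mem (Ideal.mul_mem_mul hxI h₀) (Ideal.mul_mem_mul hyI h₁)
    rw [← natCast_succ_mul_mem_iff _ j]
    have := sub_mem h3 h2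
    rwa [sub_sub_cancel] at this

end Euler

/-! ### Bases of differentials at a point of the blow up. -/

section Differentials

lemma exists_aeval_derivative_ne_zero {T κ : Type*} [CommRing T] [IsDomain T] [CharZero T]
    [CommRing κ] [Algebra T κ] (hT : Function.Injective (algebraMap T κ)) {g : κ}
    (hg : IsAlgebraic T g) : ∃ p : Polynomial T, Polynomial.aeval g p = 0 ∧
      Polynomial.aeval g (Polynomial.derivative p) ≠ 0 := by
  obtain ⟨p, hp0, hp⟩ := hg
  induction hn : p.natDegree using Nat.strong_induction_on generalizing p with
  | _ n ih =>
    by_cases h : Polynomial.aeval g (Polynomial.derivative p) = 0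
    · rcases eq_or_ne (Polynomial.derivative p) 0 with h0 | h0
      · obtain ⟨c, rfl⟩ := Polynomial.natDegree_eq_zero.1 (Polynomial.derivative_eq_zero.1 h0)
        rw [Polynomial.aeval_C] at hp
        rw [(map_eq_zero_iff _ hT).1 hp, Polynomial.C_0] at hp0
        exact absurd rfl hp0
      · have hdeg : p.natDegree ≠ 0 := fun h1 => h0 (Polynomial.derivative_of_natDegree_zero h1)
        exact ih _ (hn ▸ Polynomial.natDegree_derivative_lt hdeg) _ h0 h rfl
    · exact ⟨p, hp, h⟩

variable {R : Type*} [CommRing R] [IsLocalRing R] [Algebra ℂ R]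

/-- By Nakayama it suffices to work modulo `𝔪 Ω`. There generators of `𝔪` account for the conormal
part, and elements over whose residues the residue field is algebraic account for the rest, by
separability. -/
lemma span_D_eq_top [Algebra.EssFiniteType ℂ R] {s t : Set R}
    (hm : maximalIdeal R = Ideal.span s)
    (halg : ∀ g : R ⧸ maximalIdeal R, IsAlgebraic
      (Algebra.adjoin ℂ (Ideal.Quotient.mkₐ ℂ (maximalIdeal R) '' t)) g) :
    Submodule.span R (KaehlerDifferential.D ℂ R '' (s ∪ t)) = ⊤ := by
  set N := Submodule.span R (KaehlerDifferential.D ℂ R '' (s ∪ t)) with hN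
  set N' : Submodule R (Ω[R⁄ℂ]) := N ⊔ maximalIdeal R • ⊤ with hN'
  let D := KaehlerDifferential.D ℂ R
  let S₀ : Subalgebra ℂ R :=
    { carrier := {g | D g ∈ N'}
      mul_mem' := fun {a b} ha hb => by
        change D (a * b) ∈ N'
        rw [Derivation.leibniz]
        exact add_mem (N'.smul_mem _ hb) (N'.smul_mem _ ha)
      add_mem' := fun {a b} ha hb => by
        change D (a + b) ∈ N'
        rw [map_add]; exact add_mem ha hb
      algebraMap_mem' := fun c => by
        change D (algebraMap ℂ R c) ∈ N'
        rw [Derivation.map_algebraMap]; exact zero_mem _ }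
  have mem_S₀ : ∀ g, g ∈ S₀ ↔ D g ∈ N' := fun g => Iff.rfl
  have hs : ∀ g ∈ s ∪ t, D g ∈ N' := fun g hg =>
    Submodule.mem_sup_left (Submodule.subset_span ⟨g, hg, rfl⟩)
  have hmS : ∀ g ∈ maximalIdeal R, D g ∈ N' := by
    intro g hg
    have hg' := hg
    rw [hm] at hg'
    induction hg' using Submodule.span_induction with
    | mem g hg' => exact hs g (Or.inl hg')
    | zero => rw [map_zero]; exact zero_mem _
    | add a b ha hb iha ihb =>
      rw [map_add]; exact add_mem (iha (hm ▸ ha)) (ihb (hm ▸ hb))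
    | smul c a ha iha =>
      have ha' : a ∈ maximalIdeal R := hm ▸ ha
      rw [smul_eq_mul, Derivation.leibniz]
      exact add_mem (N'.smul_mem _ (iha ha'))
        (Submodule.mem_sup_right (Submodule.smul_mem_smul ha' trivial))
  have hD : ∀ g, D g ∈ N' := by
    intro g
    let π : R →ₐ[ℂ] R ⧸ maximalIdeal R := Ideal.Quotient.mkₐ ℂ (maximalIdeal R)
    let T := Algebra.adjoin ℂ (π '' t)
    have : CharZero T := charZero_of_injective_algebraMap (algebraMap ℂ T).injective
    obtain ⟨p, hp, hp'⟩ := exists_aeval_derivative_ne_zero (T := T)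
      (FaithfulSMul.algebraMap_injective T _) (halg (π g))
    have hlift : ∀ c : T, ∃ r ∈ S₀, π r = c := by
      have h1 : Algebra.adjoin ℂ t ≤ S₀ := Algebra.adjoin_le fun g hg => hs g (Or.inr hg)
      rintro ⟨c, hc⟩
      have : c ∈ (Algebra.adjoin ℂ t).map π := by rwa [AlgHom.map_adjoin]
      obtain ⟨r, hr, rfl⟩ := this
      exact ⟨r, h1 hr, rfl⟩
    -- Here `r` and `r'` lift `p(g)` and `p'(g)`, and `dr ≡ r' dg`. When `p(g) = 0 ≠ p'(g)` in the
    -- residue field, `r ∈ 𝔪` and `r'` is a unit, which puts `dg` in `N'`.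
    have key : ∀ p : Polynomial T, ∃ r r' : R, π r = Polynomial.aeval (π g) p ∧
        π r' = Polynomial.aeval (π g) (Polynomial.derivative p) ∧ D r - r' • D g ∈ N' := by
      intro p
      induction p using Polynomial.induction_on' with
      | add p q hp hq =>
        obtain ⟨r, r', h1, h2, h3⟩ := hp
        obtain ⟨q, q', h4, h5, h6⟩ := hq
        refine ⟨r + q, r' + q', by simp [h1, h4], by simp [h2, h5], ?_⟩
        have : D (r + q) - (r' + q') • D g = (D r - r' • D g) + (D q - q' • D g) := by
          rw [map_add, add_smul]; abel
        rw [this]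
        exact add_mem h3 h6
      | monomial n c =>
        obtain ⟨r, hr, hrc⟩ := hlift c
        refine ⟨r * g ^ n, r * (n * g ^ (n - 1)), ?_, ?_, ?_⟩
        · rw [Polynomial.aeval_monomial, map_mul, map_pow, hrc]; rfl
        · rw [Polynomial.derivative_monomial, Polynomial.aeval_monomial, map_mul, map_mul, map_pow,
            hrc, map_mul, map_natCast, map_natCast, mul_assoc]; rfl
        · have : D (r * g ^ n) - (r * (n * g ^ (n - 1))) • D g = g ^ n • D r := by
            rw [Derivation.leibniz, Derivation.leibniz_pow, ← Nat.cast_smul_eq_nsmul R, smul_smul,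
              smul_smul, ← mul_assoc, add_sub_cancel_left]
          rw [this]
          exact N'.smul_mem _ hr
    obtain ⟨r, r', h1, h2, h3⟩ := key p
    rw [hp] at h1
    have h4 : D r ∈ N' := hmS r (Ideal.Quotient.eq_zero_iff_mem.1 h1)
    have h5 : r' • D g ∈ N' := by
      have := sub_mem h4 h3
      rwa [sub_sub_cancel] at this
    have h6 : IsUnit r' := by
      by_contra h
      refine hp' ?_
      rw [← h2]
      exact Ideal.Quotient.eq_zero_iff_mem.2 ((mem_maximalIdeal _).2 h)
    exact (N'.smul_mem_iff_of_isUnit h6).1 h5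
  have htop : ⊤ ≤ N' := by
    rw [← KaehlerDifferential.span_range_derivation ℂ R, Submodule.span_le]
    rintro _ ⟨g, rfl⟩
    exact hD g
  have := Submodule.le_of_le_smul_of_le_jacobson_bot (N := N) (N' := ⊤) Module.Finite.fg_top
    (IsLocalRing.maximalIdeal_le_jacobson ⊥) htop
  exact top_le_iff.1 this

/-- A local domain of transcendence degree at most `d` whose maximal ideal is generated by the
non-degenerate sequence `x, y` has a residue field of transcendence degree at most `d - 2`. -/
lemma exists_finite_isAlgebraic_adjoin [IsDomain R] {x y : R} {d : ℕ}
    (hd : ∀ (n : ℕ) (z : Fin n → R), AlgebraicIndependent ℂ z → n ≤ d)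
    (hx0 : x ≠ 0) (hx : x ∈ maximalIdeal R) (hp : (Ideal.span {x}).IsPrime)
    (hy : y ∈ maximalIdeal R) (hyx : y ∉ Ideal.span {x}) :
    ∃ (n : ℕ) (z : Fin n → R), n + 2 ≤ d ∧ ∀ g : R ⧸ maximalIdeal R, IsAlgebraic
      (Algebra.adjoin ℂ (Ideal.Quotient.mkₐ ℂ (maximalIdeal R) '' Set.range z)) g := by
  let κ := R ⧸ maximalIdeal R
  have hcard : ∀ (n : ℕ) (z : Fin n → κ), AlgebraicIndependent ℂ z → n + 2 ≤ d := by
    intro n z hz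
    have hle : Ideal.span {x} ≤ maximalIdeal R := (Ideal.span_singleton_le_iff_mem _).2 hx
    -- Independent residues gain one element, `y`, on lifting to `R ⧸ (x)`, and another, `x`, on
    -- lifting to `R`.
    obtain ⟨z', hz'⟩ := exists_algebraicIndependent_succ (Ideal.Quotient.factorₐ ℂ hle)
      (Ideal.Quotient.factor_surjective hle) (t := Ideal.Quotient.mk _ y)
      (Ideal.Quotient.eq_zero_iff_mem.2 hy) (fun h => hyx (Ideal.Quotient.eq_zero_iff_mem.1 h)) hz
    obtain ⟨z'', hz''⟩ := exists_algebraicIndependent_succ (Ideal.Quotient.mkₐ ℂ (Ideal.span {x}))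
      Ideal.Quotient.mk_surjective (t := x)
      (Ideal.Quotient.eq_zero_iff_mem.2 (Ideal.mem_span_singleton_self x)) hx0 hz'
    exact hd _ _ hz''
  have : Nontrivial κ := Ideal.Quotient.nontrivial_iff.2 (maximalIdeal.isMaximal R).ne_top
  have : FaithfulSMul ℂ κ :=
    (faithfulSMul_iff_algebraMap_injective ℂ κ).2 (algebraMap ℂ κ).injective
  obtain ⟨s, hs⟩ := exists_isTranscendenceBasis ℂ κ
  have hfin : s.Finite := by
    by_contra hinf
    have := Set.infinite_coe_iff.2 hinf
    obtain ⟨f⟩ : Nonempty (Fin d ↪ s) := ⟨(Fin.valEmbedding).trans (Infinite.natEmbedding s)⟩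
    have := hcard d _ (hs.1.comp f f.injective)
    omega
  have := hfin.fintype
  let e := Fintype.equivFin s
  choose z hz using fun i => Ideal.Quotient.mk_surjective ((e.symm i : s) : κ)
  refine ⟨Fintype.card s, z, hcard _ _ (hs.1.comp e.symm e.symm.injective), fun g => ?_⟩
  have h1 : Ideal.Quotient.mkₐ ℂ (maximalIdeal R) '' Set.range z = Set.range ((↑) : s → κ) := by
    rw [← Set.range_comp]
    have : Ideal.Quotient.mkₐ ℂ (maximalIdeal R) ∘ z = ((↑) : s → κ) ∘ e.symm := funext hz
    rw [this, e.symm.surjective.range_comp]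
  rw [h1]
  exact hs.isAlgebraic.isAlgebraic g

lemma exists_span_D_eq_top [Algebra.EssFiniteType ℂ R] [IsDomain R] {x y : R} {d : ℕ}
    (hd : ∀ (n : ℕ) (z : Fin n → R), AlgebraicIndependent ℂ z → n ≤ d)
    (hm : maximalIdeal R = Ideal.span {x, y}) (hx0 : x ≠ 0) (hp : (Ideal.span {x}).IsPrime)
    (hyx : y ∉ Ideal.span {x}) :
    ∃ (h2 : 2 ≤ d) (e : Fin d → R), e ⟨0, by omega⟩ = x ∧ e ⟨1, by omega⟩ = y ∧
      Submodule.span R (Set.range fun i => KaehlerDifferential.D ℂ R (e i)) = ⊤ := by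
  obtain ⟨n, z, hn, hz⟩ := exists_finite_isAlgebraic_adjoin hd hx0
    (hm ▸ Ideal.subset_span (by simp)) hp (hm ▸ Ideal.subset_span (by simp)) hyx
  obtain ⟨l, rfl⟩ := Nat.exists_eq_add_of_le' (show 2 ≤ d by omega)
  -- Padding by zeros gives exactly `d` elements; only generation is claimed here.
  let e : Fin (l + 2) → R := Fin.cons x (Fin.cons y fun i : Fin l =>
    if h : i.1 < n then z ⟨i, h⟩ else 0)
  refine ⟨by omega, e, rfl, rfl, ?_⟩
  rw [← top_le_iff, ← span_D_eq_top hm hz]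
  refine Submodule.span_mono ?_
  rintro _ ⟨g, (rfl | rfl) | ⟨i, rfl⟩, rfl⟩
  · exact ⟨0, rfl⟩
  · exact ⟨1, rfl⟩
  · refine ⟨Fin.succ (Fin.succ ⟨i, by omega⟩), ?_⟩
    have : e (Fin.succ (Fin.succ ⟨i, by omega⟩)) = z i := by
      simp only [e, Fin.cons_succ]; exact dif_pos i.2
    exact congrArg _ this

variable {K : Type*} [Field K] [Algebra R K] [IsFractionRing R K] [Algebra ℂ K]
  [IsScalarTower ℂ R K]

/-- If `Ω[R⁄ℂ]` is generated by as many exact differentials as its rank, these form a basis, and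
there are corresponding partial derivatives on `R`. -/
lemma exists_basis_and_derivation [IsDomain R] {d : ℕ} {ω : ⋀[K]^d (Ω[K⁄ℂ])} (hω : ω ≠ 0)
    {e : Fin d → R}
    (he : Submodule.span R (Set.range fun i => KaehlerDifferential.D ℂ R (e i)) = ⊤) :
    ∃ (b : Module.Basis (Fin d) K (Ω[K⁄ℂ])) (δ : Fin d → Derivation ℂ R R),
      (∀ i, b i = KaehlerDifferential.D ℂ K (algebraMap R K (e i))) ∧
      (∀ g i, b.repr (KaehlerDifferential.D ℂ K (algebraMap R K g)) i = algebraMap R K (δ i g)) ∧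
      ∀ i j, δ i (e j) = if i = j then 1 else 0 := by
  let φ := KaehlerDifferential.map ℂ ℂ R K
  let v : Fin d → Ω[K⁄ℂ] := fun i => KaehlerDifferential.D ℂ K (algebraMap R K (e i))
  have hφ : ∀ i, φ (KaehlerDifferential.D ℂ R (e i)) = v i := fun i =>
    KaehlerDifferential.map_D ..
  have hg : ∀ g : R, KaehlerDifferential.D ℂ K (algebraMap R K g) ∈
      Submodule.span K (Set.range v) := by
    intro g
    have h1 := Submodule.mem_map_of_mem (f := φ)
      (he.ge (Submodule.mem_top (x := KaehlerDifferential.D ℂ R g)))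
    rw [Submodule.map_span, ← Set.range_comp] at h1
    have h2 : φ (KaehlerDifferential.D ℂ R g) = KaehlerDifferential.D ℂ K (algebraMap R K g) :=
      KaehlerDifferential.map_D ..
    rw [h2] at h1
    have h3 : φ ∘ (fun i => KaehlerDifferential.D ℂ R (e i)) = v := funext hφ
    rw [h3] at h1
    exact Submodule.span_le_restrictScalars R K _ h1
  have hspan : ⊤ ≤ Submodule.span K (Set.range v) := by
    rw [← KaehlerDifferential.span_range_derivation ℂ K, Submodule.span_le]
    rintro _ ⟨z, rfl⟩
    obtain ⟨a, c, hc, rfl⟩ := IsFractionRing.div_surjective (A := R) z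
    rw [Derivation.leibniz_div]
    exact Submodule.smul_mem _ _ (sub_mem (Submodule.smul_mem _ _ (hg a))
      (Submodule.smul_mem _ _ (hg c)))
  have hfin : Module.Finite K (Ω[K⁄ℂ]) := ⟨⟨Set.finite_range v |>.toFinset, by
    rw [Set.Finite.coe_toFinset]; exact top_le_iff.1 hspan⟩⟩
  -- A nonzero `d`-form forces rank at least `d`, and `d` generators force rank at most `d`.
  have hrank : Fintype.card (Fin d) = Module.finrank K (Ω[K⁄ℂ]) := by
    refine le_antisymm ?_ ?_
    · by_contra! hlt
      rw [Fintype.card_fin] at hlt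
      have h1 := exteriorPower.finrank_eq K (M := Ω[K⁄ℂ]) d
      rw [Nat.choose_eq_zero_of_lt hlt] at h1
      have := Module.finrank_zero_iff.1 h1
      exact hω (Subsingleton.elim _ _)
    · have := finrank_range_le_card (R := K) v
      rwa [Set.finrank, top_le_iff.1 hspan, finrank_top] at this
  let b := basisOfTopLeSpanOfCardEqFinrank v hspan hrank
  have hb : ∀ i, b i = v i := fun i => by simp [b]
  have hli : LinearIndependent R fun i => KaehlerDifferential.D ℂ R (e i) := by
    have h1 : LinearIndependent R v := by
      have h2 := b.linearIndependent.restrict_scalars' R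
      rwa [show (⇑b : Fin d → Ω[K⁄ℂ]) = v from funext hb] at h2
    exact LinearIndependent.of_comp φ (by rwa [show φ ∘ _ = v from funext hφ])
  let B := Module.Basis.mk hli he.ge
  have hB : ∀ i, B i = KaehlerDifferential.D ℂ R (e i) := fun i => by simp [B]
  refine ⟨b, fun i => (B.coord i).compDer (KaehlerDifferential.D ℂ R), hb, fun g i => ?_,
    fun i j => ?_⟩
  · have h1 : KaehlerDifferential.D ℂ K (algebraMap R K g) =
        ∑ j, algebraMap R K (B.coord j (KaehlerDifferential.D ℂ R g)) • b j := by
      have h2 : φ (KaehlerDifferential.D ℂ R g) = KaehlerDifferential.D ℂ K (algebraMap R K g) :=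
        KaehlerDifferential.map_D ..
      rw [← h2]
      conv_lhs => rw [← B.sum_repr (KaehlerDifferential.D ℂ R g), map_sum]
      refine Finset.sum_congr rfl fun j _ => ?_
      rw [map_smul, hB, hφ, hb, algebraMap_smul]
      rfl
    rw [h1, b.repr_sum_self]
    rfl
  · change B.coord i (KaehlerDifferential.D ℂ R (e j)) = _
    rw [← hB, B.coord_apply, B.repr_self, Finsupp.single_apply]
    simp only [eq_comm]

end Differentials

/-! ### The local ring at the generic point of `W`. -/

section RegularPoint

variable {A K : Type*} [CommRing A] [IsLocalRing A] [Field K] [Algebra A K]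

/-- `x ∈ 𝔪` is an equation of the exceptional fibre at the point `w`, and `x, y` generate the
maximal ideal of the two-dimensional local ring at `w`. -/
structure BlowupPoint.IsParameterPair (w : BlowupPoint A K) (x : A) (y : w.ring) : Prop where
  mem : x ∈ maximalIdeal A
  ne_zero : algebraMap A K x ≠ 0
  chart_le : blowupChart A K x ≤ w.ring
  exists_eq_div : ∀ z ∈ w.ring, ∃ a ∈ blowupChart A K x, ∃ b ∈ blowupChart A K x,
    b ≠ 0 ∧ b⁻¹ ∈ w.ring ∧ z = a / b
  maximalIdeal_eq : maximalIdeal w.ring = Ideal.span {algebraMap A w.ring x, y}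
  pow_notMem : ∀ k : ℕ, y ^ k ∉ Ideal.span {algebraMap A w.ring x}

lemma BlowupPoint.exists_isParameterPair (w : BlowupPoint A K) (hw : w.IsPrimeDivisorOfFibre)
    (hreg : IsRegularLocalRing (w.ring ⧸ w.fibreIdeal)) : ∃ x y, w.IsParameterPair x y := by
  obtain ⟨x, hx, hx0, hle, h⟩ := w.isBlowupLocalRing.exists_chart
  have hf := w.fibreIdeal_eq_span hx hx0 hle
  have hdim := hw.2
  rw [hf] at hreg hdim
  obtain ⟨y, h1, h2⟩ := exists_maximalIdeal_eq_span_pair hreg hdim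
  exact ⟨x, y, hx, hx0, hle, h, h1, h2⟩

lemma exists_pow_mul_eq_algebraMap {x : A} (hx0 : algebraMap A K x ≠ 0) {c : K}
    (hc : c ∈ blowupChart A K x) :
    ∃ (N : ℕ) (a : A), algebraMap A K x ^ N * c = algebraMap A K a := by
  unfold blowupChart at hc
  induction hc using Algebra.adjoin_induction with
  | mem c hc =>
    obtain ⟨a, -, rfl⟩ := hc
    exact ⟨1, a, by rw [pow_one, mul_div_cancel₀ _ hx0]⟩
  | algebraMap r => exact ⟨0, r, by simp⟩
  | add a b _ _ ha hb =>
    obtain ⟨N, a', ha⟩ := ha; obtain ⟨M, b', hb⟩ := hb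
    refine ⟨N + M, x ^ M * a' + x ^ N * b', ?_⟩
    rw [map_add, map_mul, map_mul, ← ha, ← hb, map_pow, map_pow]; ring
  | mul a b _ _ ha hb =>
    obtain ⟨N, a', ha⟩ := ha; obtain ⟨M, b', hb⟩ := hb
    refine ⟨N + M, a' * b', ?_⟩
    rw [map_mul, ← ha, ← hb]; ring

lemma BlowupPoint.isNoetherianRing [IsDomain A] [IsNoetherianRing A] [IsFractionRing A K]
    (w : BlowupPoint A K) : IsNoetherianRing w.ring :=
  have := w.isBlowupLocalRing.essFiniteType
  Algebra.EssFiniteType.isNoetherianRing A w.ring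

namespace BlowupPoint.IsParameterPair

variable {w : BlowupPoint A K} {x : A} {y : w.ring} (h : w.IsParameterPair x y)
include h

lemma algebraMap_ne_zero : algebraMap A w.ring x ≠ 0 := fun h0 =>
  h.ne_zero (congrArg Subtype.val h0)

lemma y_mem : y ∈ maximalIdeal w.ring :=
  h.maximalIdeal_eq ▸ Ideal.subset_span (by simp)

lemma notMem_center {P : PrimeDivisor A K} (hP : P.1.center ≠ maximalIdeal A)
    (hle : w.ring ≤ P.1.ring) : x ∉ P.1.center := by
  intro hx
  refine hP (le_antisymm (IsLocalRing.le_maximalIdeal (Ideal.IsPrime.ne_top inferInstance))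
    fun a ha => ?_)
  have h1 : algebraMap A P.1.ring a =
      ⟨_, hle (h.chart_le (div_mem_blowupChart ha))⟩ * algebraMap A P.1.ring x :=
    Subtype.ext (div_mul_cancel₀ _ h.ne_zero).symm
  change algebraMap A P.1.ring a ∈ maximalIdeal P.1.ring
  rw [h1]
  exact Ideal.mul_mem_left _ _ hx

variable [IsDomain A] [IsNoetherianRing A] [IsFractionRing A K]

/-- The trace on `𝒪_w` of the maximal ideal of the exceptional divisor is generated by `x`. -/
lemma comap_maximalIdeal {Q : BlowupDivisor A K} (hQ : Q.1.center = maximalIdeal A)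
    (hle : w.ring ≤ Q.1.ring) :
    (maximalIdeal Q.1.ring).comap (Subalgebra.inclusion hle) =
      Ideal.span {algebraMap A w.ring x} := by
  have := w.isNoetherianRing
  have hx : algebraMap A w.ring x ∈
      (maximalIdeal Q.1.ring).comap (Subalgebra.inclusion hle) := by
    have : x ∈ Q.1.center := hQ ▸ h.mem
    exact this
  have hprime : ((maximalIdeal Q.1.ring).comap (Subalgebra.inclusion hle)).IsPrime :=
    Ideal.IsPrime.comap _
  -- Were the trace the maximal ideal, `𝒪_Q` would equal `𝒪_w`. With `m = ord_Q x`, the element `y ^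
  -- m / x` would lie in it, so `x` would divide a power of `y`.
  refine (eq_span_or_eq_maximalIdeal h.maximalIdeal_eq hx).resolve_right fun hq => ?_
  have hmem : ∀ z ∈ Q.1.ring, z ∈ w.ring := by
    intro z hz
    obtain ⟨a, ha, b, hb, hb0, hb', rfl⟩ := w.isBlowupLocalRing.exists_eq_div Q.2 hz
    have hbu : IsUnit (⟨b, hb⟩ : w.ring) := by
      by_contra hcon
      have h1 : (⟨b, hb⟩ : w.ring) ∈ (maximalIdeal Q.1.ring).comap (Subalgebra.inclusion hle) :=
        hq ▸ (mem_maximalIdeal _).2 hcon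
      rw [Ideal.mem_comap, Q.1.mem_maximalIdeal_iff] at h1
      rcases h1 with h1 | h1
      · exact h1 hb'
      · exact hb0 (congrArg (Subtype.val : Q.1.ring → K) h1)
    obtain ⟨c, hc⟩ := hbu.exists_right_inv
    have h2 : b * c = 1 := congrArg (Subtype.val : w.ring → K) hc
    rw [div_eq_mul_inv, ← eq_inv_of_mul_eq_one_right h2]
    exact mul_mem ha c.2
  have hy0 : (y : K) ≠ 0 := fun h0 => h.pow_notMem 1 (by
    rw [pow_one, show y = 0 from Subtype.ext h0]; exact zero_mem _)
  have hy : 1 ≤ Q.1.ord y := by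
    refine (Q.1.mem_maximalIdeal_iff_ord (v := Subalgebra.inclusion hle y) hy0).1 ?_
    change y ∈ (maximalIdeal Q.1.ring).comap (Subalgebra.inclusion hle)
    rw [hq]; exact h.y_mem
  refine h.pow_notMem (Q.1.ord (algebraMap A K x)).toNat ?_
  rw [Ideal.mem_span_singleton']
  refine ⟨⟨y ^ (Q.1.ord (algebraMap A K x)).toNat / algebraMap A K x, hmem _ ?_⟩, Subtype.ext
    (div_mul_cancel₀ _ h.ne_zero)⟩
  rw [← Q.1.ord_nonneg_iff (div_ne_zero (pow_ne_zero _ hy0) h.ne_zero),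
    Q.1.ord_div (pow_ne_zero _ hy0) h.ne_zero, Q.1.ord_pow]
  have := Q.1.ord_nonneg_of_mem (Q.1.ring.algebraMap_mem x)
  have h3 : (((Q.1.ord (algebraMap A K x)).toNat : ℕ) : ℤ) = Q.1.ord (algebraMap A K x) :=
    Int.toNat_of_nonneg this
  nlinarith

lemma notMem_span_iff {Q : BlowupDivisor A K} (hQ : Q.1.center = maximalIdeal A)
    (hle : w.ring ≤ Q.1.ring) {r : w.ring} :
    r ∉ Ideal.span {algebraMap A w.ring x} ↔ (r : K) ≠ 0 ∧ Q.1.ord r = 0 := by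
  rcases eq_or_ne (r : K) 0 with h0 | h0
  · simp [show r = 0 from Subtype.ext h0]
  have h1 := Q.1.mem_maximalIdeal_iff_ord (v := Subalgebra.inclusion hle r) h0
  rw [← h.comap_maximalIdeal hQ hle, Ideal.mem_comap, h1]
  have : 0 ≤ Q.1.ord r := Q.1.ord_nonneg_of_mem (hle r.2)
  rw [Subalgebra.coe_inclusion]
  constructor
  · intro h2; exact ⟨h0, by omega⟩
  · rintro ⟨-, h2⟩; omega

/-- Elements of `𝒪_w` vanishing on `Q` are multiples of `x`, and elements of `𝒪_Q` are fractions of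
elements of `𝒪_w` with denominators that are units along `Q`. Hence `x` divides a uniformizer. -/
lemma ord_exceptional {Q : BlowupDivisor A K} (hQ : Q.1.center = maximalIdeal A)
    (hle : w.ring ≤ Q.1.ring) : Q.1.ord (algebraMap A K x) = 1 := by
  have hx : ¬ ((algebraMap A w.ring x : w.ring) : K) ≠ 0 ∨
      Q.1.ord ((algebraMap A w.ring x : w.ring) : K) ≠ 0 := by
    rw [← not_and_or, ← h.notMem_span_iff hQ hle, not_not]
    exact Ideal.mem_span_singleton_self _
  have hx1 : Q.1.ord (algebraMap A K x) ≠ 0 := hx.resolve_left (not_not.2 h.ne_zero)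
  have hx0 := Q.1.ord_nonneg_of_mem (Q.1.ring.algebraMap_mem x)
  obtain ⟨t, ht0, ht, ht1⟩ := Q.1.exists_uniformizer
  obtain ⟨a, ha, b, hb, hb0, hb', rfl⟩ := w.isBlowupLocalRing.exists_eq_div Q.2 ht
  have ha0 : a ≠ 0 := by rintro rfl; exact ht0 (zero_div _)
  have hb1 : Q.1.ord b = 0 := Q.1.ord_eq_zero_of_mem (hle hb) hb'
  rw [Q.1.ord_div ha0 hb0, hb1, sub_zero] at ht1
  have ha2 : (⟨a, ha⟩ : w.ring) ∈ Ideal.span {algebraMap A w.ring x} := by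
    by_contra hcon
    have := ((h.notMem_span_iff hQ hle).1 hcon).2
    change Q.1.ord a = 0 at this
    omega
  obtain ⟨c, hc⟩ := Ideal.mem_span_singleton'.1 ha2
  have hc' : (c : K) * algebraMap A K x = a := congrArg (Subtype.val : w.ring → K) hc
  have hc0 : (c : K) ≠ 0 := by intro h0; rw [h0, zero_mul] at hc'; exact ha0 hc'.symm
  rw [← hc', Q.1.ord_mul hc0 h.ne_zero] at ht1
  have := Q.1.ord_nonneg_of_mem (hle c.2)
  omega

/-- The local ring at `w` is the intersection of the local rings of the prime divisors
through `w`. -/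
lemma mem_ring_of_forall_ord_nonneg [IsIntegrallyClosed A] {Q : BlowupDivisor A K}
    (hQ : Q.1.center = maximalIdeal A) (hle : w.ring ≤ Q.1.ring) {u : K} (hu0 : u ≠ 0)
    (hu : 0 ≤ Q.1.ord u) (hP : ∀ P : PrimeDivisor A K, w.ring ≤ P.1.ring → 0 ≤ P.1.ord u) :
    u ∈ w.ring := by
  have := w.isNoetherianRing
  have hxp := isPrime_span_singleton h.maximalIdeal_eq h.pow_notMem
  have hyx : y ∉ Ideal.span {algebraMap A w.ring x} := by simpa using h.pow_notMem 1
  by_contra hcon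
  obtain ⟨a, q, hq, -, hmem⟩ := exists_isPrime_forall_mem_iff (S := w.ring) u (maximalIdeal w.ring)
    fun s r hsr => by
      by_contra hs
      rw [mem_maximalIdeal, mem_nonunits_iff, not_not] at hs
      obtain ⟨s', hs'⟩ := hs.exists_left_inv
      refine hcon ?_
      have h1 : (s' : K) * s = 1 := congrArg (Subtype.val : w.ring → K) hs'
      have h2 : (s : K) * u = r := hsr
      have : u = s' * r := by rw [← h2, ← mul_assoc, h1, one_mul]
      rw [this]
      exact mul_mem s'.2 r.2
  have hmem : ∀ s : w.ring, s ∈ q ↔ ∃ r : w.ring, (s : K) * (a * u) = r := hmem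
  -- The associated prime `q` of `u` modulo `𝒪_w` is `(x)`, excluded by regularity along `Q`, or
  -- maximal, or does not contain `x`.
  by_cases hxq : algebraMap A w.ring x ∈ q
  · rcases eq_span_or_eq_maximalIdeal h.maximalIdeal_eq hxq with hq' | hq'
    · obtain ⟨c, hc, b, hb, hb0, hb', hu'⟩ :=
        w.isBlowupLocalRing.exists_eq_div Q.2 ((Q.1.ord_nonneg_iff hu0).1 hu)
      have hbq : (⟨b, hb⟩ : w.ring) ∈ q := (hmem _).2 ⟨a * ⟨c, hc⟩, by
        change b * (a * u) = a * c
        rw [hu']; field_simp⟩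
      rw [hq'] at hbq
      exact ((h.notMem_span_iff hQ hle).2 ⟨hb0, Q.1.ord_eq_zero_of_mem (hle hb) hb'⟩) hbq
    -- Depth two: `y α = β x` with `(x)` prime and `y ∉ (x)` forces `x ∣ α`, so `a u` is already in
    -- `𝒪_w`.
    · obtain ⟨α, hα⟩ := (hmem _).1 hxq
      obtain ⟨β, hβ⟩ := (hmem y).1 (hq' ▸ h.y_mem)
      have h1 : y * α = β * algebraMap A w.ring x := Subtype.ext (by
        change (y : K) * α = β * (algebraMap A w.ring x : w.ring)
        rw [← hα, ← hβ]; ring)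
      have h2 : α ∈ Ideal.span {algebraMap A w.ring x} :=
        (hxp.mem_or_mem (h1 ▸ Ideal.mul_mem_left _ _ (Ideal.mem_span_singleton_self _) :
          y * α ∈ _)).resolve_left hyx
      obtain ⟨γ, rfl⟩ := Ideal.mem_span_singleton'.1 h2
      refine hq.one_notMem ((hmem 1).2 ⟨γ, ?_⟩)
      have h3 : algebraMap A K x * (a * u) = γ * algebraMap A K x := hα
      rw [OneMemClass.coe_one, one_mul]
      exact mul_left_cancel₀ h.ne_zero (h3.trans (mul_comm _ _))
  -- Away from `x = 0` the blow up is locally `X`, where Hartogs yields a prime divisor through `w`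
  -- along which `u` has a pole.
  · have hp : (q.comap (algebraMap A w.ring)).IsPrime := Ideal.IsPrime.comap _
    have hup : u ∉ localSubalgebra K (q.comap (algebraMap A w.ring)) := by
      intro hu'
      obtain ⟨c, b, hb, rfl⟩ := mem_localSubalgebra.1 hu'
      have hb0 : algebraMap A K b ≠ 0 := by
        intro h0; rw [h0, div_zero] at hu0; exact hu0 rfl
      refine hb ((hmem _).2 ⟨a * algebraMap A w.ring c, ?_⟩)
      change algebraMap A K b * (a * (algebraMap A K c / algebraMap A K b)) = a * algebraMap A K c
      field_simp
    obtain ⟨P, hPc, hPu, -⟩ := exists_primeDivisor _ hup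
    refine hPu ((P.1.ord_nonneg_iff hu0).1 (hP P ?_))
    have hxP := P.1.inv_algebraMap_mem fun hx => hxq (hPc hx)
    have hchart : blowupChart A K x ≤ P.1.ring := Algebra.adjoin_le (by
      rintro _ ⟨a, -, rfl⟩
      rw [div_eq_mul_inv]
      exact mul_mem (P.1.ring.algebraMap_mem a) hxP)
    intro z hz
    obtain ⟨c, hc, b, hb, hb0, hb', rfl⟩ := h.exists_eq_div z hz
    rw [div_eq_mul_inv]
    refine mul_mem (hchart hc) ?_
    obtain ⟨N, β, hβ⟩ := exists_pow_mul_eq_algebraMap h.ne_zero hb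
    have hβP : β ∉ P.1.center := fun hβ' => by
      have h1 : algebraMap A w.ring β ∈ q := hPc hβ'
      have h2 : algebraMap A w.ring β = algebraMap A w.ring x ^ N * ⟨b, h.chart_le hb⟩ :=
        Subtype.ext hβ.symm
      rw [h2] at h1
      rcases hq.mem_or_mem h1 with h3 | h3
      · exact hxq (hq.mem_of_pow_mem _ h3)
      · have h4 := Ideal.mul_mem_left q ⟨b⁻¹, hb'⟩ h3
        have h5 : (⟨b⁻¹, hb'⟩ : w.ring) * ⟨b, h.chart_le hb⟩ = 1 :=
          Subtype.ext (inv_mul_cancel₀ hb0)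
        rw [h5] at h4
        exact hq.one_notMem h4
    have h6 : b⁻¹ = algebraMap A K x ^ N * (algebraMap A K β)⁻¹ := by
      rw [← hβ, mul_inv, ← mul_assoc, mul_inv_cancel₀ (pow_ne_zero _ h.ne_zero), one_mul]
    rw [h6]
    exact mul_mem (pow_mem (P.1.ring.algebraMap_mem x) _) (P.1.inv_algebraMap_mem hβP)

end BlowupPoint.IsParameterPair

end RegularPoint

/-! ### Orders of partial derivatives. -/

section Estimates

variable {A K : Type*} [CommRing A] [Field K] [Algebra A K] [Algebra ℂ K] {d : ℕ}

/-- With `v = df` this turns the volume form with `df` in slot `i` into the `i`-th partial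
derivative of `f` times the volume form. -/
lemma ιMulti_update_basis (b : Module.Basis (Fin d) K (Ω[K⁄ℂ])) (i : Fin d) (v : Ω[K⁄ℂ]) :
    exteriorPower.ιMulti K d (Function.update b i v) =
      b.repr v i • exteriorPower.ιMulti K d b := by
  have : (exteriorPower.ιMulti K d).toMultilinearMap.toLinearMap b i =
      (LinearMap.toSpanSingleton K _ (exteriorPower.ιMulti K d b)) ∘ₗ b.coord i := by
    refine b.ext fun j => ?_
    change exteriorPower.ιMulti K d (Function.update b i (b j)) =
      b.repr (b j) i • exteriorPower.ιMulti K d b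
    rcases eq_or_ne j i with rfl | hji
    · simp
    · rw [b.repr_self, Finsupp.single_eq_of_ne hji.symm, zero_smul]
      exact AlternatingMap.map_update_self _ _ hji.symm
  exact LinearMap.congr_fun this v

variable [IsFractionRing A K] [Algebra ℂ A] [IsScalarTower ℂ A K] (E : DivisorOver A K)
  [Algebra.EssFiniteType ℂ E.ring]

/-- If `b` is a basis of differentials at `w`, then `ordForm ω E - E.ord c` is the order along `E`
of the volume form of `b`, that is, the discrepancy of `E` over `X⁺`. -/
lemma ord_le_ord_add_of_ιMulti_eq (b : Module.Basis (Fin d) K (Ω[K⁄ℂ])) {ω : ⋀[K]^d (Ω[K⁄ℂ])}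
    {c : K} (hω : ω ≠ 0) (hc : ω = c • exteriorPower.ιMulti K d b) {θ e : K} (hθ : θ ≠ 0)
    (he : e ≠ 0) (h : ∃ η ∈ regularForms d E, θ • exteriorPower.ιMulti K d b = e • η) :
    E.ord e ≤ E.ord θ + (ordForm ω E - E.ord c) := by
  obtain ⟨η, hη, h⟩ := h
  have hc0 : c ≠ 0 := by rintro rfl; exact hω (by rw [hc, zero_smul])
  have h1 : ω = (c / θ * e) • η := by
    rw [mul_smul, ← h, smul_smul, div_mul_cancel₀ _ hθ, hc]
  have h2 := ord_le_ordForm E b hω hη h1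
  rw [E.ord_mul (div_ne_zero hc0 hθ) he, E.ord_div hc0 hθ] at h2
  omega

lemma ord_le_ord_repr_D_add {b : Module.Basis (Fin d) K (Ω[K⁄ℂ])} {ω : ⋀[K]^d (Ω[K⁄ℂ])}
    {c : K} (hω : ω ≠ 0) (hc : ω = c • exteriorPower.ιMulti K d b)
    (hb : ∀ i, b i ∈ regularDifferentials E) {f : K} (hf : f ∈ E.ring) (hf0 : f ≠ 0) {i : Fin d}
    (hi : b.repr (KaehlerDifferential.D ℂ K f) i ≠ 0) :
    E.ord f ≤ E.ord (b.repr (KaehlerDifferential.D ℂ K f) i) + (ordForm ω E - E.ord c + 1) := by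
  obtain ⟨e, he0, he, h⟩ := ιMulti_eq_smul_of_D E (w := Function.update b i
    (KaehlerDifferential.D ℂ K f)) hf hf0 (Function.update_self ..)
    fun l hl => by rw [Function.update_of_ne hl]; exact hb l
  rw [ιMulti_update_basis] at h
  have := ord_le_ord_add_of_ιMulti_eq E b hω hc hi he0 h
  omega

/-- The form `dx` stays in slot `j`, so the logarithmic bound for `dx ∧ df` applies and gains `ord_E
x` over the bound for `df` alone. -/
lemma ord_add_ord_le_ord_repr_D_add {b : Module.Basis (Fin d) K (Ω[K⁄ℂ])} {ω : ⋀[K]^d (Ω[K⁄ℂ])}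
    {c : K} (hω : ω ≠ 0) (hc : ω = c • exteriorPower.ιMulti K d b)
    (hb : ∀ i, b i ∈ regularDifferentials E) {x f : K} (hx : x ∈ E.ring) (hx0 : x ≠ 0)
    (hf : f ∈ E.ring) (hf0 : f ≠ 0) {i j : Fin d} (hji : j ≠ i)
    (hj : b j = KaehlerDifferential.D ℂ K x) (hi : b.repr (KaehlerDifferential.D ℂ K f) i ≠ 0) :
    E.ord x + E.ord f ≤
      E.ord (b.repr (KaehlerDifferential.D ℂ K f) i) + (ordForm ω E - E.ord c + 1) := by
  obtain ⟨e, he0, he, h⟩ := ιMulti_eq_smul_of_D_of_D E (w := Function.update b i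
    (KaehlerDifferential.D ℂ K f)) hji hx hx0 hf hf0
    (by rw [Function.update_of_ne hji]; exact hj) (Function.update_self ..) fun l => by
      rcases eq_or_ne l i with rfl | hl
      · rw [Function.update_self]; exact D_mem_regularDifferentials E hf
      · rw [Function.update_of_ne hl]; exact hb l
  rw [ιMulti_update_basis] at h
  have := ord_le_ord_add_of_ιMulti_eq E b hω hc hi he0 h
  omega

end Estimates

/-! ### Independence of the pull back from choices. -/

section OrderOfPullback

variable {A K : Type*} [CommRing A] [IsDomain A] [IsLocalRing A] [IsNoetherianRing A]
  [IsIntegrallyClosed A] [Field K] [Algebra A K] [IsFractionRing A K]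

lemma ord_eq_zero_of_forall_primeDivisor {z : K} (hz : z ≠ 0)
    (h : ∀ P : PrimeDivisor A K, P.1.ord z = 0) (E : DivisorOver A K) : E.ord z = 0 := by
  obtain ⟨a, ha⟩ := mem_range_of_forall_ord_nonneg hz fun P => (h P).ge
  obtain ⟨b, hb⟩ := mem_range_of_forall_ord_nonneg (A := A) (inv_ne_zero hz) fun P => by
    rw [P.1.ord_inv, h, neg_zero]
  exact E.ord_eq_zero_of_mem (ha ▸ E.ring.algebraMap_mem a) (hb ▸ E.ring.algebraMap_mem b)

lemma pullbackOrd_eq_ord {D : PrimeDivisor A K → ℤ} {g : K} (hg : g ≠ 0)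
    (h : ∀ P, P.1.ord g = D P) (E : DivisorOver A K) : pullbackOrd D E = E.ord g := by
  have hD : IsQCartier D := ⟨(1, g), one_pos, hg, fun P => by simp [h]⟩
  unfold pullbackOrd
  rw [dif_pos hD]
  obtain ⟨hr, h0, hP⟩ := hD.choose_spec
  have hp := pow_ne_zero hD.choose.1 hg
  have h1 := ord_eq_zero_of_forall_primeDivisor (A := A) (div_ne_zero h0 hp) (fun P => by
    rw [P.1.ord_div h0 hp, hP, P.1.ord_pow, h, sub_self]) E
  rw [E.ord_div h0 hp, E.ord_pow, sub_eq_zero] at h1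
  rw [h1, Int.cast_mul, Int.cast_natCast, mul_div_cancel_left₀]
  exact Nat.cast_ne_zero.2 hr.ne'

end OrderOfPullback

/-! ### Discrepancies and the equation of the strict transform near `w`. -/

section LocalEquations

variable {A K : Type*} [CommRing A] [IsLocalRing A] [Field K] [Algebra A K] [IsFractionRing A K]
  {w : BlowupPoint A K} {x : A} {y : w.ring} {Q : BlowupDivisor A K}

lemma BlowupPoint.IsParameterPair.ord_eq_zero_of_primeDivisor (h : w.IsParameterPair x y)
    {P : PrimeDivisor A K}
    (hP : P.1.center ≠ maximalIdeal A) (hle : w.ring ≤ P.1.ring) :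
    P.1.ord (algebraMap A K x) = 0 :=
  P.1.ord_eq_zero_of_mem (P.1.ring.algebraMap_mem x)
    (P.1.inv_algebraMap_mem (h.notMem_center hP hle))

variable [IsDomain A] [IsNoetherianRing A] [IsIntegrallyClosed A]

namespace BlowupPoint.IsParameterPair

lemma ord_eq_zero_of_forall (h : w.IsParameterPair x y) (hQ : Q.1.center = maximalIdeal A)
    (hle : w.ring ≤ Q.1.ring) {u : K} (hu0 : u ≠ 0) (hu : Q.1.ord u = 0)
    (hP : ∀ P : PrimeDivisor A K, w.ring ≤ P.1.ring → P.1.ord u = 0) {E : DivisorOver A K}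
    (hE : w.ring ≤ E.ring) : E.ord u = 0 :=
  E.ord_eq_zero_of_mem
    (hE (h.mem_ring_of_forall_ord_nonneg hQ hle hu0 hu.ge fun P hP' => (hP P hP').ge))
    (hE (h.mem_ring_of_forall_ord_nonneg hQ hle (inv_ne_zero hu0)
      (by rw [Q.1.ord_inv, hu, neg_zero]) fun P hP' => by rw [P.1.ord_inv, hP P hP', neg_zero]))

/-- If `r K_X = div f`, then `c ^ r / (f x ^ r)` is a unit at `w`: along `Q` its order vanishes
because `a(Q, X) = 1`, and along the other prime divisors because `c` computes `K_X` there. Its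
order along `E` is therefore zero. -/
lemma discrepancy_eq [Algebra ℂ K] {d : ℕ} {ω : ⋀[K]^d (Ω[K⁄ℂ])} (h : w.IsParameterPair x y)
    (hQ : Q.1.center = maximalIdeal A) (hle : w.ring ≤ Q.1.ring)
    (hne : ∀ P : PrimeDivisor A K, P.1.center ≠ maximalIdeal A)
    (hK : IsQCartier (canonicalDivisor (A := A) ω)) (hdisc : discrepancy ω Q.1 = 1) {c : K}
    (hc : c ≠ 0) (hcQ : ordForm ω Q.1 = Q.1.ord c)
    (hcP : ∀ P : PrimeDivisor A K, w.ring ≤ P.1.ring → ordForm ω P.1 = P.1.ord c)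
    {E : DivisorOver A K} (hE : w.ring ≤ E.ring) :
    discrepancy ω E = ordForm ω E - E.ord c + E.ord (algebraMap A K x) := by
  unfold discrepancy pullbackOrd at hdisc ⊢
  rw [dif_pos hK] at hdisc ⊢
  obtain ⟨hr, h0, hP⟩ := hK.choose_spec
  set r := hK.choose.1
  set f := hK.choose.2
  have hr0 : (r : ℚ) ≠ 0 := Nat.cast_ne_zero.2 hr.ne'
  have hx := h.ne_zero
  have hcr := pow_ne_zero r hc
  have hxr := pow_ne_zero r hx
  have hord : ∀ E : DivisorOver A K, E.ord (c ^ r / (f * algebraMap A K x ^ r)) =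
      r * E.ord c - (E.ord f + r * E.ord (algebraMap A K x)) := fun E => by
    rw [E.ord_div hcr (mul_ne_zero h0 hxr), E.ord_mul h0 hxr, E.ord_pow, E.ord_pow]
  have h1 := h.ord_eq_zero_of_forall hQ hle (div_ne_zero hcr (mul_ne_zero h0 hxr))
    (by
      rw [hord, h.ord_exceptional hQ hle]
      rw [hcQ] at hdisc
      field_simp at hdisc
      have : Q.1.ord c * (r : ℤ) - Q.1.ord f = r := by exact_mod_cast hdisc
      linarith)
    (fun P hP' => by
      rw [hord, h.ord_eq_zero_of_primeDivisor (hne P) hP', hP]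
      unfold canonicalDivisor
      rw [hcP P hP']; ring) hE
  rw [hord] at h1
  have h2 : (r : ℚ) * E.ord c - (E.ord f + r * E.ord (algebraMap A K x)) = 0 := by
    exact_mod_cast h1
  field_simp
  linear_combination h2

/-- The equation of `D⁺` at `w`. -/
lemma exists_strictTransformIdeal_eq_span (h : w.IsParameterPair x y)
    (hQ : Q.1.center = maximalIdeal A) (hle : w.ring ≤ Q.1.ring)
    (hne : ∀ P : PrimeDivisor A K, P.1.center ≠ maximalIdeal A) {D : PrimeDivisor A K →₀ ℕ} {g : K}
    (hg : g ≠ 0) (hD : ∀ P, P.1.ord g = D P) :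
    ∃ f : w.ring, w.strictTransformIdeal D = Ideal.span {f} ∧
      f ∉ Ideal.span {algebraMap A w.ring x} ∧
      (f : K) = g / algebraMap A K x ^ Q.1.ord g := by
  have hx := zpow_ne_zero (Q.1.ord g) h.ne_zero
  have hf0 := div_ne_zero hg hx
  have hfQ : Q.1.ord (g / algebraMap A K x ^ Q.1.ord g) = 0 := by
    rw [Q.1.ord_div hg hx, Q.1.ord_zpow, h.ord_exceptional hQ hle]; ring
  have hfP : ∀ P : PrimeDivisor A K, w.ring ≤ P.1.ring →
      P.1.ord (g / algebraMap A K x ^ Q.1.ord g) = D P := fun P hP => by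
    rw [P.1.ord_div hg hx, P.1.ord_zpow, h.ord_eq_zero_of_primeDivisor (hne P) hP, hD]; ring
  refine ⟨⟨_, h.mem_ring_of_forall_ord_nonneg hQ hle hf0 hfQ.ge fun P hP =>
    (hfP P hP).symm ▸ Int.natCast_nonneg _⟩, le_antisymm (fun z hz => ?_) ?_,
    (h.notMem_span_iff hQ hle).2 ⟨hf0, hfQ⟩, rfl⟩
  · rcases eq_or_ne (z : K) 0 with hz0 | hz0
    · rw [show z = 0 from Subtype.ext hz0]; exact zero_mem _
    simp only [strictTransformIdeal, Submodule.mem_iInf, Ideal.mem_comap] at hz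
    refine Ideal.mem_span_singleton'.2 ⟨⟨z / (g / algebraMap A K x ^ Q.1.ord g),
      h.mem_ring_of_forall_ord_nonneg hQ hle (div_ne_zero hz0 hf0) ?_ fun P hP => ?_⟩,
      Subtype.ext (div_mul_cancel₀ _ hf0)⟩
    · rw [Q.1.ord_div hz0 hf0, hfQ, sub_zero]
      exact Q.1.ord_nonneg_of_mem (hle z.2)
    · rw [P.1.ord_div hz0 hf0, hfP P hP, sub_nonneg]
      exact (P.1.mem_maximalIdeal_pow_iff (v := Subalgebra.inclusion hP z) hz0 _).1 (hz P hP)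
  · rw [Ideal.span_singleton_le_iff_mem]
    simp only [strictTransformIdeal, Submodule.mem_iInf, Ideal.mem_comap]
    intro P hP
    rw [P.1.mem_maximalIdeal_pow_iff (by exact hf0)]
    exact (hfP P hP).ge

end BlowupPoint.IsParameterPair

end LocalEquations

/-! ### Bounding a valuation by a multiplicity. -/

section Induction

variable {R : Type*} [CommRing R] [Algebra ℂ R] {x y : R} {v : R → ℤ}

/-- Differentiating in `y` costs at most `L` and lowers the exponent by at most one; after at most
`k` steps the element lies outside `(x, y)`, where `v` vanishes. -/
lemma le_mul_of_notMem_span_pow (δ : Derivation ℂ R R) (hx : δ x = 0) (hy : δ y = 1) {L : ℤ}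
    (hL : 0 ≤ L) (h0 : ∀ f ∉ Ideal.span {x, y}, v f = 0)
    (h : ∀ f, f ≠ 0 → δ f ≠ 0 → v f ≤ v (δ f) + L) {k : ℕ} {f : R}
    (hf : f ∉ Ideal.span {x, y ^ (k + 1)}) : v f ≤ k * L := by
  induction k generalizing f with
  | zero => rw [h0 f (by simpa using hf)]; simp
  | succ k ih =>
    by_cases hm : f ∈ Ideal.span {x, y}
    · have h1 : δ f ∉ Ideal.span {x, y ^ (k + 1)} :=
        fun h1 => hf (mem_span_pow_succ_of_derivation δ hx hy hm h1)
      have h2 := h f (fun h2 => hf (h2 ▸ zero_mem _)) fun h2 => h1 (h2 ▸ zero_mem _)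
      have := ih h1
      push_cast
      linarith
    · rw [h0 f hm]; positivity

/-- The same descent for powers of `(x, y)`: at each step one of the two derivatives stays outside
the next lower power. -/
lemma le_mul_of_notMem_pow (δ₀ δ₁ : Derivation ℂ R R) (h₀x : δ₀ x = 1) (h₀y : δ₀ y = 0)
    (h₁x : δ₁ x = 0) (h₁y : δ₁ y = 1) {T : ℤ}
    (hT : 0 ≤ T) (h0 : ∀ f ∉ Ideal.span {x, y}, v f = 0)
    (h₀ : ∀ f, f ≠ 0 → δ₀ f ≠ 0 → v f ≤ v (δ₀ f) + T)
    (h₁ : ∀ f, f ≠ 0 → δ₁ f ≠ 0 → v f ≤ v (δ₁ f) + T) {k : ℕ} {f : R}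
    (hf : f ∉ Ideal.span {x, y} ^ (k + 1)) : v f ≤ k * T := by
  induction k generalizing f with
  | zero => rw [h0 f (by simpa using hf)]; simp
  | succ k ih =>
    by_cases hm : f ∈ Ideal.span {x, y}
    · have hf0 : f ≠ 0 := fun h2 => hf (h2 ▸ zero_mem _)
      have key : ∀ δ : Derivation ℂ R R, (∀ f, f ≠ 0 → δ f ≠ 0 → v f ≤ v (δ f) + T) →
          δ f ∉ Ideal.span {x, y} ^ (k + 1) → v f ≤ (k + 1 : ℕ) * T := fun δ hδ h1 => by
        have h2 := hδ f hf0 fun h2 => h1 (h2 ▸ zero_mem _)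
        have := ih h1
        push_cast
        linarith
      by_cases h1 : δ₀ f ∈ Ideal.span {x, y} ^ (k + 1)
      · exact key δ₁ h₁ fun h2 =>
          hf (mem_pow_succ_of_derivation δ₀ δ₁ h₀x h₀y h₁x h₁y hm h1 h2)
      · exact key δ₀ h₀ h1
    · rw [h0 f hm]; positivity

end Induction

/-! ### Reading off multiplicities from an equation. -/

section MultiplicityAlong

variable {R : Type*} [CommRing R] [IsLocalRing R]

lemma exists_mem_pow_notMem_pow_succ [IsNoetherianRing R] {f : R} (hf : f ≠ 0) :
    ∃ k : ℕ, f ∈ maximalIdeal R ^ k ∧ f ∉ maximalIdeal R ^ (k + 1) := by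
  classical
  have h : ∃ k, f ∉ maximalIdeal R ^ k := by
    by_contra! h
    have h1 := Ideal.iInf_pow_eq_bot_of_isLocalRing (maximalIdeal R)
      (maximalIdeal.isMaximal R).ne_top
    exact hf ((Submodule.mem_bot R).1 (h1 ▸ (Submodule.mem_iInf _).2 h))
  obtain ⟨k, hk⟩ : ∃ k, Nat.find h = k + 1 := Nat.exists_eq_succ_of_ne_zero fun h0 =>
    Nat.find_spec h (by rw [h0, pow_zero, Ideal.one_eq_top]; exact Submodule.mem_top)
  exact ⟨k, not_not.1 (Nat.find_min h (by omega)), hk ▸ Nat.find_spec h⟩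

lemma iSup_le_pow_eq {f : R} {k : ℕ} (h : f ∈ maximalIdeal R ^ k)
    (h' : f ∉ maximalIdeal R ^ (k + 1)) :
    (⨆ (j : ℕ) (_ : Ideal.span {f} ≤ maximalIdeal R ^ j), (j : ℕ∞)) = k := by
  refine le_antisymm (iSup₂_le fun j hj => ?_)
    (le_iSup₂_of_le k ((Ideal.span_singleton_le_iff_mem _).2 h) le_rfl)
  rw [Nat.cast_le]
  by_contra! hlt
  exact h' (Ideal.pow_le_pow_right hlt ((Ideal.span_singleton_le_iff_mem _).1 hj))

/-- Membership would give `(u - b y) y ^ k ∈ (x)` with `u - b y` a unit. -/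
lemma notMem_span_pair_pow_succ {x y u s : R} (hxy : maximalIdeal R = Ideal.span {x, y})
    (hy : ∀ k : ℕ, y ^ k ∉ Ideal.span {x}) (hu : IsUnit u) (k : ℕ) :
    u * y ^ k + x * s ∉ Ideal.span {x, y ^ (k + 1)} := by
  intro h
  obtain ⟨a, b, hab⟩ := Ideal.mem_span_pair.1 h
  have hub : IsUnit (u - b * y) := by
    by_contra hcon
    have h1 : u - b * y ∈ maximalIdeal R := (mem_maximalIdeal _).2 hcon
    have h2 : b * y ∈ maximalIdeal R :=
      Ideal.mul_mem_left _ _ (hxy ▸ Ideal.subset_span (by simp))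
    exact (mem_maximalIdeal _).1 (((maximalIdeal R).sub_mem_iff_left h2).1 h1) hu
  refine hy k ((Ideal.unit_mul_mem_iff_mem _ hub).1 (Ideal.mem_span_singleton'.2 ⟨a - s, ?_⟩))
  linear_combination hab

end MultiplicityAlong

/-! ### Orders of forms along divisors through `w`. -/

section OrderOfForm

variable {A K : Type*} [CommRing A] [IsLocalRing A] [Field K] [Algebra A K] [IsFractionRing A K]
  [Algebra ℂ K] {d : ℕ}

/-- At the divisors on `X⁺` through `w` the basis of differentials at `w` generates the lattice of
regular differentials. -/
lemma ordForm_eq_ord_of_forall_exists_eq_div {w : BlowupPoint A K} {E : DivisorOver A K}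
    (hE : w.ring ≤ E.ring)
    (hdiv : ∀ z ∈ E.ring, ∃ a ∈ w.ring, ∃ b ∈ w.ring, b ≠ 0 ∧ b⁻¹ ∈ E.ring ∧ z = a / b)
    {b : Module.Basis (Fin d) K (Ω[K⁄ℂ])} (hb : ∀ i, b i ∈ regularDifferentials E)
    (hrepr : ∀ (g : w.ring) i, b.repr (KaehlerDifferential.D ℂ K (g : K)) i ∈ w.ring)
    {ω : ⋀[K]^d (Ω[K⁄ℂ])} {c : K} (hω : ω ≠ 0) (hc : ω = c • exteriorPower.ιMulti K d b) :
    ordForm ω E = E.ord c := by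
  refine ordForm_eq_ord E b (fun η hη i => ?_) hb hω hc
  induction hη using Submodule.span_induction with
  | mem η hη =>
    obtain ⟨⟨z, hz⟩, rfl⟩ := hη
    obtain ⟨s, hs, t, ht, -, ht', rfl⟩ := hdiv z hz
    change b.repr (KaehlerDifferential.D ℂ K (s / t)) i ∈ E.ring
    rw [Derivation.leibniz_div, map_smul, map_sub, map_smul, map_smul]
    exact mul_mem (pow_mem ht' 2) (sub_mem (mul_mem (hE ht) (hE (hrepr ⟨s, hs⟩ i)))
      (mul_mem (hE hs) (hE (hrepr ⟨t, ht⟩ i))))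
  | zero => simp
  | add η θ _ _ hη hθ => rw [map_add]; exact add_mem hη hθ
  | smul a η _ hη =>
    rw [show a • η = (a : K) • η from rfl, map_smul]
    exact mul_mem a.2 hη

end OrderOfForm

end SingGerm

end

theorem theorem3p1 {A K : Type*} [CommRing A] [IsDomain A] [IsLocalRing A] [IsIntegrallyClosed A]
    [Algebra ℂ A] [Algebra.EssFiniteType ℂ A]
    [Field K] [Algebra A K] [IsFractionRing A K] [Algebra ℂ K] [IsScalarTower ℂ A K]
    (hclosed : ∀ a : A, ∃ c : ℂ, a - algebraMap ℂ A c ∈ IsLocalRing.maximalIdeal A)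
    (d : ℕ) (hd : 3 ≤ d) (hdim : ringKrullDim A = d)
    (hisolated : ∀ p : PrimeSpectrum A, p.asIdeal ≠ IsLocalRing.maximalIdeal A →
      IsRegularLocalRing (Localization.AtPrime p.asIdeal))
    (ω : ⋀[K]^d (Ω[K⁄ℂ])) (hω : ω ≠ 0)
    (hK : SingGerm.IsQCartier (SingGerm.canonicalDivisor (A := A) ω))
    (Q : SingGerm.BlowupDivisor A K) (hG : SingGerm.ConditionG ω Q)
    (n : ℕ) (hn : 0 < n) (D : SingGerm.PrimeDivisor A K →₀ ℕ) (ν : ℤ) (hν : ν ≤ 2 * n)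
    (hlin : SingGerm.LinEquiv (SingGerm.strictTransform D)
      (fun P => -ν * SingGerm.primeAsDivisor Q P))
    (hcan : SingGerm.IsCanonicalOutside ω n (fun P => (D P : ℤ)))
    (E : SingGerm.DivisorOver A K) (hEQ : E ≠ Q.1)
    (hE : SingGerm.IsNonLCSingularity ω n (fun P => (D P : ℤ)) E)
    (w : SingGerm.BlowupPoint A K) (hw : w.IsPrimeDivisorOfFibre) (hwE : w.IsCenterOf E) :
    (∃ μ : ℕ, w.intersectionMultiplicity D = μ ∧ n < μ) ∧
    (∃ k : ℕ, w.multAlong D = k ∧ ((n : ℤ) ≤ ν → 2 * (n : ℤ) < ν + k)) := by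
  have hA : IsNoetherianRing A := Algebra.EssFiniteType.isNoetherianRing ℂ A
  obtain ⟨x, y, h⟩ := w.exists_isParameterPair hw (hG.regular w hw.1 hw.2.le)
  have hQ := hG.center_eq
  have hle := hG.irreducible w hw.1
  obtain ⟨hwE, -⟩ := hwE
  have hwN := w.isNoetherianRing
  have hwess : Algebra.EssFiniteType A w.ring := w.isBlowupLocalRing.essFiniteType
  have hwess' : Algebra.EssFiniteType ℂ w.ring := .comp ℂ A w.ring
  have hEess := E.essFiniteType
  have hEess' : Algebra.EssFiniteType ℂ E.ring := .comp ℂ A E.ring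
  have hfrac : IsFractionRing w.ring K := IsFractionRing.of_field w.ring K fun z => by
    obtain ⟨a, b, _, rfl⟩ := IsFractionRing.div_surjective (A := A) z
    exact ⟨algebraMap A w.ring a, algebraMap A w.ring b, rfl⟩
  have hht : (IsLocalRing.maximalIdeal A).height = d := by
    have := IsLocalRing.maximalIdeal_height_eq_ringKrullDim (R := A)
    rw [hdim] at this
    exact_mod_cast this
  have hht1 : (IsLocalRing.maximalIdeal A).height ≠ 1 := by
    rw [hht]; exact_mod_cast (by omega : d ≠ 1)
  have hne : ∀ P : SingGerm.PrimeDivisor A K, P.1.center ≠ IsLocalRing.maximalIdeal A :=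
    fun P hP => hht1 (hP ▸ P.2)
  -- Coordinates at `w` and the corresponding basis of the differentials.
  have hxp := SingGerm.isPrime_span_singleton h.maximalIdeal_eq h.pow_notMem
  obtain ⟨h2, e, he0, he1, he⟩ := SingGerm.exists_span_D_eq_top (d := d)
    (fun m z hz => SingGerm.card_le_of_algebraicIndependent (K := K) hclosed hdim
      (hz.map' (f := IsScalarTower.toAlgHom ℂ w.ring K) (IsFractionRing.injective w.ring K)))
    h.maximalIdeal_eq h.algebraMap_ne_zero hxp (by simpa using h.pow_notMem 1)
  obtain ⟨b, δ, hb, hδ, hδe⟩ := SingGerm.exists_basis_and_derivation (K := K) hω he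
  obtain ⟨c, hc⟩ := SingGerm.exists_eq_smul_ιMulti_basis b ω
  have hc0 : c ≠ 0 := by rintro rfl; exact hω (by rw [hc, zero_smul])
  have hreg : ∀ F : SingGerm.DivisorOver A K, w.ring ≤ F.ring →
      ∀ i, b i ∈ SingGerm.regularDifferentials F := fun F hF i =>
    hb i ▸ SingGerm.D_mem_regularDifferentials F (hF (e i).2)
  have hrepr : ∀ (g : w.ring) i, b.repr (KaehlerDifferential.D ℂ K (g : K)) i ∈ w.ring :=
    fun g i => (hδ g i).symm ▸ (δ i g).2
  have hcQ : SingGerm.ordForm ω Q.1 = Q.1.ord c :=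
    SingGerm.ordForm_eq_ord_of_forall_exists_eq_div hle
      (fun z hz => w.isBlowupLocalRing.exists_eq_div Q.2 hz) (hreg _ hle) hrepr hω hc
  have hcP : ∀ P : SingGerm.PrimeDivisor A K, w.ring ≤ P.1.ring →
      SingGerm.ordForm ω P.1 = P.1.ord c := fun P hP =>
    SingGerm.ordForm_eq_ord_of_forall_exists_eq_div hP
      (fun z hz => w.isBlowupLocalRing.exists_eq_div (P.isBlowupLocalRing (hne P)) hz)
      (hreg _ hP) hrepr hω hc
  -- The equation of `D`.
  obtain ⟨g, hg, hgP⟩ := hlin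
  -- The linear equivalence says `div g = D⁺ + ν Q` on `X⁺`. Hence `D = div g` on `X`, and `g` has
  -- order `ν` along `Q`.
  have hgD : ∀ P : SingGerm.PrimeDivisor A K, P.1.ord g = D P := fun P => by
    have h1 := hgP ⟨P.1, P.isBlowupLocalRing (hne P)⟩
    have hPQ : (⟨P.1, P.isBlowupLocalRing (hne P)⟩ : SingGerm.BlowupDivisor A K) ≠ Q :=
      fun hPQ => hne P (hQ ▸ hPQ ▸ rfl)
    simp only [SingGerm.strictTransform, SingGerm.primeAsDivisor, dif_pos P.2, if_neg hPQ] at h1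
    simpa using h1.symm
  have hgQ : Q.1.ord g = ν := by
    have h1 := hgP Q
    simp only [SingGerm.strictTransform, SingGerm.primeAsDivisor, hQ, dif_neg hht1, if_true] at h1
    simpa using h1.symm
  obtain ⟨f, hDf, hfx, hfg⟩ :=
    h.exists_strictTransformIdeal_eq_span hQ hle hne hg hgD
  rw [hgQ] at hfg
  -- The inequality in terms of orders.
  have hfg' : E.ord g = ν * E.ord (algebraMap A K x) + E.ord f := by
    rw [hfg, E.ord_div hg (zpow_ne_zero _ h.ne_zero), E.ord_zpow]; ring
  -- `T` is the log discrepancy of `E` over `X⁺`.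
  obtain ⟨T, hT⟩ : ∃ T, T = SingGerm.ordForm ω E - E.ord c + 1 := ⟨_, rfl⟩
  have hineq : n * (T + E.ord (algebraMap A K x)) < ν * E.ord (algebraMap A K x) + E.ord f := by
    unfold SingGerm.IsNonLCSingularity at hE
    rw [SingGerm.pullbackOrd_eq_ord hg hgD, h.discrepancy_eq hQ hle hne hK hG.discrepancy_eq hc0 hcQ
      hcP hwE, hfg'] at hE
    rw [hT]
    have : (n : ℤ) * (SingGerm.ordForm ω E - E.ord c + E.ord (algebraMap A K x) + 1) <
      ν * E.ord (algebraMap A K x) + E.ord f := by exact_mod_cast hE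
    linarith
  have hord0 : ∀ r ∉ Ideal.span {algebraMap A w.ring x, y}, E.ord (r : K) = 0 := by
    intro r hr
    rw [← h.maximalIdeal_eq, IsLocalRing.mem_maximalIdeal, mem_nonunits_iff, not_not] at hr
    obtain ⟨r', hr'⟩ := hr.exists_right_inv
    have hr'' : (r : K) * r' = 1 := congrArg (Subtype.val : w.ring → K) hr'
    exact E.ord_eq_zero_of_mem (hwE r.2) (by rw [← eq_inv_of_mul_eq_one_right hr'']; exact hwE r'.2)
  have hcoe : ∀ r : w.ring, r ≠ 0 → (r : K) ≠ 0 := fun r hr h0 => hr (Subtype.ext h0)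
  have hest : ∀ i (r : w.ring), r ≠ 0 → δ i r ≠ 0 → E.ord (r : K) ≤ E.ord (δ i r : K) + T := by
    intro i r hr hδr
    have h1 : b.repr (KaehlerDifferential.D ℂ K (r : K)) i = δ i r := hδ r i
    have h3 := SingGerm.ord_le_ord_repr_D_add E hω hc (hreg E hwE) (hwE r.2) (hcoe r hr) (i := i)
      (by rw [h1]; exact hcoe _ hδr)
    rwa [h1, ← hT] at h3
  let i₀ : Fin d := ⟨0, by omega⟩
  let i₁ : Fin d := ⟨1, by omega⟩
  have hi : i₀ ≠ i₁ := by simp [i₀, i₁]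
  have hest' : ∀ r : w.ring, r ≠ 0 → δ i₁ r ≠ 0 →
      E.ord (r : K) ≤ E.ord (δ i₁ r : K) + (T - E.ord (algebraMap A K x)) := by
    intro r hr hδr
    have h1 : b.repr (KaehlerDifferential.D ℂ K (r : K)) i₁ = δ i₁ r := hδ r i₁
    have h3 := SingGerm.ord_add_ord_le_ord_repr_D_add E hω hc (hreg E hwE)
      (E.ring.algebraMap_mem x) h.ne_zero (hwE r.2) (hcoe r hr) hi
      ((hb i₀).trans (by rw [he0]; rfl))
      (by rw [h1]; exact hcoe _ hδr)
    rw [h1, ← hT] at h3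
    linarith
  have h00 : δ i₀ (algebraMap A w.ring x) = 1 := he0 ▸ (hδe i₀ i₀).trans (if_pos rfl)
  have h01 : δ i₀ y = 0 := he1 ▸ (hδe i₀ i₁).trans (if_neg hi)
  have h10 : δ i₁ (algebraMap A w.ring x) = 0 := he0 ▸ (hδe i₁ i₀).trans (if_neg hi.symm)
  have h11 : δ i₁ y = 1 := he1 ▸ (hδe i₁ i₁).trans (if_pos rfl)
  have hx0 : 0 ≤ E.ord (algebraMap A K x) := E.ord_nonneg_of_mem (E.ring.algebraMap_mem x)
  have hL : 0 ≤ T - E.ord (algebraMap A K x) := by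
    have hy0 : y ≠ 0 := fun h0 => h.pow_notMem 1 (by rw [h0, pow_one]; exact zero_mem _)
    -- The estimate for `y` itself, whose derivative is `1`, reads `0 ≤ ord_E y ≤ L`.
    have h1 := hest' y hy0 (by rw [h11]; exact one_ne_zero)
    rw [h11, OneMemClass.coe_one, E.ord_one] at h1
    have := E.ord_nonneg_of_mem (hwE y.2)
    linarith
  have hf0 : f ≠ 0 := fun h0 => hfx (h0 ▸ zero_mem _)
  refine ⟨?_, ?_⟩
  · obtain ⟨k, u, s, hu, hf⟩ := SingGerm.exists_eq_unit_mul_pow_add h.maximalIdeal_eq hfx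
    refine ⟨k, ?_, ?_⟩
    · unfold SingGerm.BlowupPoint.intersectionMultiplicity SingGerm.BlowupPoint.intersectionIdeal
        SingGerm.colength
      rw [hDf, w.fibreIdeal_eq_span h.mem h.ne_zero h.chart_le, hf]
      exact SingGerm.length_quotient_sup h.maximalIdeal_eq h.pow_notMem hu
    · have h1 := SingGerm.le_mul_of_notMem_span_pow (v := fun r : w.ring => E.ord (r : K)) (δ i₁)
        h10 h11 hL hord0 hest' (hf ▸ SingGerm.notMem_span_pair_pow_succ h.maximalIdeal_eq h.pow_notMem
          hu k : f ∉ _)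
      by_contra! hk
      have hk : (k : ℤ) ≤ n := by exact_mod_cast hk
      -- With `L = T - ord_E x`, the bound `ν ≤ 2n` turns `hineq` into `n L < ord_E f`, whereas
      -- `ord_E f ≤ k L ≤ n L`.
      nlinarith [mul_le_mul_of_nonneg_right hk hL, mul_le_mul_of_nonneg_right hν hx0]
  · obtain ⟨k, hk, hk'⟩ := SingGerm.exists_mem_pow_notMem_pow_succ hf0
    refine ⟨k, ?_, fun hnν => ?_⟩
    · unfold SingGerm.BlowupPoint.multAlong
      rw [hDf]
      exact SingGerm.iSup_le_pow_eq hk hk'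
    · rw [h.maximalIdeal_eq] at hk'
      have h1 := SingGerm.le_mul_of_notMem_pow (v := fun r : w.ring => E.ord (r : K)) (δ i₀) (δ i₁)
        h00 h01 h10 h11 (by linarith) hord0 (hest i₀) (hest i₁) hk'
      by_contra! hcon
      have hkn : (k : ℤ) ≤ 2 * n - ν := by linarith
      -- Inserting `ord_E f ≤ k T ≤ (2n - ν) T` into `hineq` leaves `(ν - n) (T - ord_E x) < 0`,
      -- though both factors are nonnegative.
      nlinarith [mul_le_mul_of_nonneg_right hkn (by linarith : 0 ≤ T),
        mul_nonneg (sub_nonneg.2 hnν) hL]
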